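/- Let $\alpha,\beta>-1$, let $j\ge 0$ be an integer, let $\gamma\in\mathbb{R}$ and $M>0$, and let $\{M_n\}_{n\ge 0}$ be a sequence of nonnegative real numbers with $\lim_{n\to\infty}M_n n^{\gamma}=M$. For each $n\ge 0$ let $Q_n$ be the real polynomial of degree $n$ that is orthogonal to all real polynomials of degree less than $n$ with respect to $$(f,g)_{S,n}=\int_{-1}^1 f(x)g(x)(1-x)^{\alpha}(1+x)^{\beta}\,dx+M_n f^{(j)}(1)g^{(j)}(1)$$ and has the same leading coefficient as the Jacobi polynomial $P_n^{(\alpha,\beta)}$ normalized by $P_n^{(\alpha,\beta)}(1)=\binom{n+\alpha}{n}$. Let $J_\nu(x)=\sum_{k\ge0}\frac{(-1)^k}{k!\,\Gamma(k+\nu+1)}\left(\frac x2\right)^{2k+\nu}$ be the Bessel function of the first kind; $\left(\frac x2\right)^{-\alpha}J_{\alpha+2i}(x)$ denotes the corresponding entire function. Then $$\lim_{n\to\infty}\frac{Q_n(\cos(x/n))}{n^{\alpha}}=\lim_{n\to\infty}\frac{Q_n\left(1-\frac{x^2}{2n^2}\right)}{n^{\alpha}}=\begin{cases}\phi_{\alpha}(x),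 & \gamma>2(\alpha+2j+1),\\ \psi_{\alpha,j}(x), & \gamma=2(\alpha+2j+1),\\ \varphi_{\alpha,j}(x), & \gamma<2(\alpha+2j+1),\end{cases}$$ both limits being uniform on compact subsets of $\mathbb{C}$, where $$\phi_\alpha(x)=\left(\frac x2\right)^{-\alpha}J_\alpha(x),$$ and $\psi_{\alpha,j}$ and $\varphi_{\alpha,j}$ are both of the form $$\sum_{i=0}^{j+1}b_i2^{i}\left(\frac{x}{2}\right)^{-\alpha}J_{\alpha+2i}(x),$$ with coefficients computed recursively, for $0\le i\le j+1$, by $$b_i=(-1)^i\,\frac{r_i-\Gamma(\alpha+i+1)\sum_{k=0}^{i-1}b_k\binom{i}{k}\frac{(-1)^{k}k!\,2^{k}}{\Gamma(\alpha+i+k+1)}}{i!\,\frac{2^i\Gamma(\alpha+i+1)}{\Gamma(\alpha+2i+1)}}$$ (the empty sum is $0$). Here, for $\psi_{\alpha,j}$, $$r_i=\frac{M(i-j)+\Gamma^2(\alpha+j+1)2^{\alpha+\beta+2j+1}(\alpha+2j+1)(\alpha+j+i+1)}{(\alpha+j+i+1)\left(M+\Gamma^2(\alpha+j+1)2^{\alpha+\beta+2j+1}(\alpha+2j+1)\right)},$$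 and, for $\varphi_{\alpha,j}$, $$r_i=\frac{i-j}{\alpha+j+i+1}.$$ -/

import Mathlib

open Polynomial Filter Topology

noncomputable section

/-- The Jacobi polynomial `P_n^{(α,β)}`, normalized by `P_n^{(α,β)}(1) = (α+1)_n / n!`:
`(1/n!) ∑_{k ≤ n} binom(n,k) (n+α+β+1)_k (α+k+1)_{n-k} ((x-1)/2)^k`. -/
def jacobiPoly (α β : ℝ) (n : ℕ) : ℝ[X] :=
  ∑ k ∈ Finset.range (n + 1),
    C ((n.choose k : ℝ) * (ascPochhammer ℝ k).eval ((n : ℝ) + α + β + 1) *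
        (ascPochhammer ℝ (n - k)).eval (α + (k : ℝ) + 1) / (n.factorial : ℝ)) *
      (C (1 / 2 : ℝ) * (X - 1)) ^ k

/-- The discrete Jacobi–Sobolev inner product with mass `m` on the `j`-th derivative at `1`. -/
def sobolevInner (α β : ℝ) (j : ℕ) (m : ℝ) (f g : ℝ[X]) : ℝ :=
  (∫ x in (-1 : ℝ)..1, f.eval x * g.eval x * (1 - x) ^ α * (1 + x) ^ β) +
    m * (derivative^[j] f).eval 1 * (derivative^[j] g).eval 1

/-- `Q` is the degree `n` orthogonal polynomial of `sobolevInner α β j m`, with the same leading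
coefficient as `P_n^{(α,β)}`. -/
structure IsJacobiSobolev (α β : ℝ) (j : ℕ) (m : ℝ) (n : ℕ) (Q : ℝ[X]) : Prop where
  natDegree_eq : Q.natDegree = n
  leadingCoeff_eq : Q.leadingCoeff = (jacobiPoly α β n).leadingCoeff
  orthogonal : ∀ p : ℝ[X], p.degree < n → sobolevInner α β j m Q p = 0

/-- The Bessel function of the first kind `J_ν` (principal branch of the powers). -/
def besselJ (ν : ℝ) (z : ℂ) : ℂ :=
  ∑' k : ℕ, (-1 : ℂ) ^ k / ((k.factorial : ℂ) * (Real.Gamma (k + ν + 1) : ℂ)) *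
    (z / 2) ^ ((2 * k + ν : ℝ) : ℂ)

/-- The entire function `(z/2)^{-α} J_{α+2i}(z)`. At the removable singularity `z = 0` it takes its
limit value, which is `1/Γ(α+1)` for `i = 0` and `0` for `i ≥ 1`. -/
def scaledBessel (α : ℝ) (i : ℕ) (z : ℂ) : ℂ :=
  if z = 0 then (if i = 0 then 1 / (Real.Gamma (α + 1) : ℂ) else 0)
  else (z / 2) ^ (-α : ℂ) * besselJ (α + 2 * i) z

/-- The power series of `scaledBessel`, valid at every `z`, including `z = 0`. -/
theorem scaledBessel_eq_tsum (α : ℝ) (i : ℕ) (z : ℂ) :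
    scaledBessel α i z = ∑' k : ℕ, (-1 : ℂ) ^ k /
      ((k.factorial : ℂ) * (Real.Gamma (k + (α + 2 * i) + 1) : ℂ)) * (z / 2) ^ (2 * (k + i)) := by
  unfold scaledBessel
  split_ifs with hz hi
  · subst hz hi
    rw [tsum_eq_single 0]
    · simp
    · intro k hk
      simp [hk]
  · subst hz
    symm
    convert tsum_zero with k
    simp [hi]
  · unfold besselJ
    rw [← tsum_mul_left]
    congr 1
    ext k
    have hz2 : z / 2 ≠ 0 := by simpa using hz
    have he : (-α : ℂ) + ((2 * k + (α + 2 * i) : ℝ) : ℂ) = ((2 * (k + i) : ℕ) : ℂ) := by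
      push_cast
      ring
    rw [mul_left_comm, ← Complex.cpow_add _ _ hz2, he, Complex.cpow_natCast]

/-- The coefficients `b_i` computed recursively from the data `r`:
`b_i = (-1)^i (r_i - Γ(α+i+1) ∑_{k<i} b_k binom(i,k) (-1)^k k! 2^k / Γ(α+i+k+1))
  / (i! 2^i Γ(α+i+1) / Γ(α+2i+1))`. -/
def besselCoeff (α : ℝ) (r : ℕ → ℝ) (i : ℕ) : ℝ :=
  (-1) ^ i *
    (r i - Real.Gamma (α + i + 1) *
      ∑ k : Fin i, besselCoeff α r k * (i.choose k : ℝ) *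
        ((-1) ^ (k : ℕ) * ((k : ℕ).factorial : ℝ) * 2 ^ (k : ℕ)) /
          Real.Gamma (α + i + (k : ℕ) + 1)) /
    ((i.factorial : ℝ) * (2 ^ i * Real.Gamma (α + i + 1) / Real.Gamma (α + 2 * i + 1)))
termination_by i
decreasing_by exact k.isLt

/-- `Γ(α+j+1)² 2^{α+β+2j+1} (α+2j+1)`. -/
def criticalMass (α β : ℝ) (j : ℕ) : ℝ :=
  Real.Gamma (α + j + 1) ^ 2 * (2 : ℝ) ^ (α + β + 2 * j + 1) * (α + 2 * j + 1)

/-- The data of the recursion in the critical case `γ = 2(α+2j+1)`. -/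
def psiData (α β : ℝ) (j : ℕ) (M : ℝ) (i : ℕ) : ℝ :=
  (M * ((i : ℝ) - j) + criticalMass α β j * (α + j + i + 1)) /
    ((α + j + i + 1) * (M + criticalMass α β j))

/-- The data of the recursion in the case `γ < 2(α+2j+1)`. -/
def varphiData (α : ℝ) (j : ℕ) (i : ℕ) : ℝ :=
  ((i : ℝ) - j) / (α + j + i + 1)

/-- The function `∑_{i=0}^{j+1} b_i 2^i (z/2)^{-α} J_{α+2i}(z)`. -/
def besselCombination (α : ℝ) (j : ℕ) (b : ℕ → ℝ) (z : ℂ) : ℂ :=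
  ∑ i ∈ Finset.range (j + 2), (b i : ℂ) * 2 ^ i * scaledBessel α i z

def phiLimit (α : ℝ) (z : ℂ) : ℂ := scaledBessel α 0 z

def psiLimit (α β : ℝ) (j : ℕ) (M : ℝ) (z : ℂ) : ℂ :=
  besselCombination α j (besselCoeff α (psiData α β j M)) z

def varphiLimit (α : ℝ) (j : ℕ) (z : ℂ) : ℂ :=
  besselCombination α j (besselCoeff α (varphiData α j)) z

/-- Both `n^{-α} Q_n(cos(z/n))` and `n^{-α} Q_n(1 - z²/(2n²))` converge to `F`, uniformly on
compact subsets of `ℂ`. -/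
def MehlerHeine (α : ℝ) (Q : ℕ → ℝ[X]) (F : ℂ → ℂ) : Prop :=
  ∀ K : Set ℂ, IsCompact K →
    TendstoUniformlyOn
      (fun (n : ℕ) (z : ℂ) => aeval (Complex.cos (z / n)) (Q n) / (((n : ℝ) ^ α : ℝ) : ℂ))
      F atTop K ∧
    TendstoUniformlyOn
      (fun (n : ℕ) (z : ℂ) => aeval (1 - z ^ 2 / (2 * (n : ℂ) ^ 2)) (Q n) / (((n : ℝ) ^ α : ℝ) : ℂ))
      F atTop K

end

namespace JacobiSobolev

/-! Everything is read off the Taylor coefficients at 1. Since Q_n and P_n share their leading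
coefficient, Q_n - P_n expands in the Jacobi polynomials of lower degree, and Sobolev orthogonality
determines the expansion: Q_n is P_n minus M_n Q_n^{(j)}(1) times the j-th derivative, in the second
variable at 1, of the Christoffel–Darboux kernel (`taylor_coeff_eq_of_isJacobiSobolev`). The j-th
Taylor coefficient of this relation is a linear equation that determines Q_n^{(j)}(1).

The i-th Taylor coefficient of P_n grows like n^{α+2i}, and the squared norm of P_n decays like 1/n.
Summing these power laws shows that the kernel coefficients grow like n^{2(α+i+j+1)}. Hence the
rescaled i-th coefficient of Q_n tends to r_i times that of the Bessel limit of P_n, with r_i = 1 -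
τ(α+2j+1)/(c(α+j+i+1)) and c = `criticalMass α β j`. Here τ is the limit of `dampedMass`: it is 0,
M/(1+M/c) or c according to the size of γ.

All Jacobi and kernel coefficients are nonnegative and have a common majorant that defines an entire
series. Coefficientwise convergence therefore becomes locally uniform convergence
(`mehlerHeine_of_taylor`).

It remains to recognize ∑ r_s z^{2s}(…) as a finite Bessel combination. Comparing power series gives
a triangular system for infinitely many b_i. Because r_s(α+j+s+1) is affine in s, the system
truncated after b_{j+1} becomes, once denominators are cleared, a polynomial identity of degree at
most j+1 in s. It holds at the j+2 points s = 0, …, j+1, hence everywhere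
(`eq_sum_besselCoeff_range`). -/

/-! ### Rising factorials and alternating binomial sums. -/

theorem Gamma_add_natCast {x : ℝ} (hx : 0 < x) (n : ℕ) :
    Real.Gamma (x + n) = (ascPochhammer ℝ n).eval x * Real.Gamma x := by
  induction n with
  | zero => simp
  | succ n ih =>
    have h : x + n ≠ 0 := by positivity
    rw [ascPochhammer_succ_eval, Nat.cast_succ, ← add_assoc, Real.Gamma_add_one h, ih]
    ring

theorem ascPochhammer_eval_add (x : ℝ) (a b : ℕ) :
    (ascPochhammer ℝ (a + b)).eval x =
      (ascPochhammer ℝ a).eval x * (ascPochhammer ℝ b).eval (x + a) := by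
  rw [← ascPochhammer_mul]
  simp

theorem fwdDiff_iter_eq_alternating_sum (f : ℝ → ℝ) (n : ℕ) (y : ℝ) :
    (fwdDiff (1 : ℝ))^[n] f y =
      (-1) ^ n * ∑ k ∈ Finset.range (n + 1), (-1) ^ k * (n.choose k : ℝ) * f (y + k) := by
  rw [fwdDiff_iter_eq_sum_shift, Finset.mul_sum]
  refine Finset.sum_congr rfl fun k hk => ?_
  have hk' : k ≤ n := Nat.lt_succ_iff.mp (Finset.mem_range.mp hk)
  obtain ⟨l, rfl⟩ := Nat.exists_eq_add_of_le hk'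
  have h2 : ((-1 : ℝ) ^ k) * (-1) ^ k = 1 := by
    rw [← mul_pow]; norm_num
  simp only [add_tsub_cancel_left, zsmul_eq_mul, nsmul_eq_mul, mul_one, pow_add]
  push_cast
  linear_combination (-(-1) ^ l * ((k + l).choose k : ℝ) * f (y + k)) * h2

theorem alternating_sum_polynomial_eq_zero (p : ℝ[X]) (n : ℕ) (hp : p.natDegree < n) :
    ∑ k ∈ Finset.range (n + 1), (-1) ^ k * (n.choose k : ℝ) * p.eval (k : ℝ) = 0 := by
  have h := congrFun (Polynomial.fwdDiff_iter_eq_zero_of_degree_lt hp) 0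
  rw [fwdDiff_iter_eq_alternating_sum] at h
  simpa using h

/-- Induction: with (c)_k the rising factorial, (c)_{n+2} = c (c+1)_{n+1} = (c)_{n+1} (c+n+1), so
differencing 1/(c)_{n+1} produces the factor -(n+1)/(c)_{n+2}. -/
theorem fwdDiff_iter_inv (n : ℕ) {c : ℝ} (hc : 0 < c) :
    (fwdDiff (1 : ℝ))^[n] (fun x : ℝ => x⁻¹) c =
      (-1) ^ n * n.factorial / (ascPochhammer ℝ (n + 1)).eval c := by
  induction n generalizing c with
  | zero => simp
  | succ n ih =>
    rw [Function.iterate_succ_apply', fwdDiff, ih hc, ih (by positivity)]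
    have h1 : (ascPochhammer ℝ (n + 1 + 1)).eval c =
        c * (ascPochhammer ℝ (n + 1)).eval (c + 1) := by
      rw [add_comm (n + 1) 1, ascPochhammer_eval_add]
      simp
    have h2 := ascPochhammer_succ_eval (S := ℝ) (n + 1) c
    have p1 := ascPochhammer_pos (n + 1) c hc
    have p2 := ascPochhammer_pos (n + 1) (c + 1) (by positivity)
    rw [h1, div_sub_div _ _ p2.ne' p1.ne', div_eq_div_iff (by positivity) (by positivity),
      Nat.factorial_succ]
    rw [h1] at h2
    push_cast at h2 ⊢
    rw [pow_succ]
    linear_combination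
      (-((-1) ^ n * (n.factorial : ℝ)) * (ascPochhammer ℝ (n + 1)).eval (c + 1)) * h2

theorem alternating_sum_div (n : ℕ) {c : ℝ} (hc : 0 < c) :
    ∑ k ∈ Finset.range (n + 1), (-1) ^ k * (n.choose k : ℝ) * (c + k)⁻¹ =
      n.factorial / (ascPochhammer ℝ (n + 1)).eval c := by
  have h := fwdDiff_iter_inv n hc
  rw [fwdDiff_iter_eq_alternating_sum, mul_div_assoc] at h
  exact mul_left_cancel₀ (pow_ne_zero _ (by norm_num)) h

/-- Dividing p by x + c leaves the constant p(-c) and a quotient of degree below n, which the n-th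
difference kills. Only the residue at the pole -c survives. -/
theorem alternating_sum_polynomial_div (p : ℝ[X]) (n : ℕ) (hp : p.natDegree ≤ n) {c : ℝ}
    (hc : 0 < c) :
    ∑ k ∈ Finset.range (n + 1), (-1) ^ k * (n.choose k : ℝ) * (p.eval (k : ℝ) * (c + k)⁻¹) =
      p.eval (-c) * (n.factorial / (ascPochhammer ℝ (n + 1)).eval c) := by
  obtain ⟨q, hq⟩ : (X - C (-c)) ∣ p - C (p.eval (-c)) := by
    rw [dvd_iff_isRoot]; simp
  have hpk : ∀ k : ℕ, p.eval (k : ℝ) * (c + k)⁻¹ = p.eval (-c) * (c + k)⁻¹ + q.eval (k : ℝ) := by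
    intro k
    have h := congrArg (eval (k : ℝ)) hq
    have hk : c + k ≠ 0 := by positivity
    simp at h
    field_simp
    linear_combination h
  have hS : ∑ k ∈ Finset.range (n + 1), (-1) ^ k * (n.choose k : ℝ) * q.eval (k : ℝ) = 0 := by
    by_cases hq0 : q = 0
    · simp [hq0]
    apply alternating_sum_polynomial_eq_zero
    have h := congrArg natDegree hq
    rw [natDegree_sub_C, (monic_X_sub_C _).natDegree_mul' hq0, natDegree_X_sub_C] at h
    omega
  simp_rw [hpk, mul_add, Finset.sum_add_distrib]
  rw [hS, add_zero, ← alternating_sum_div n hc, Finset.mul_sum]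
  exact Finset.sum_congr rfl fun k _ => by ring

/-! ### Beta integrals and moments of the Jacobi weight. -/

theorem integral_rpow_mul_one_sub_rpow {u v : ℝ} (hu : 0 < u) (hv : 0 < v) :
    ∫ x in (0 : ℝ)..1, x ^ (u - 1) * (1 - x) ^ (v - 1) =
      Real.Gamma u * Real.Gamma v / Real.Gamma (u + v) := by
  have h := ProbabilityTheory.beta_eq_betaIntegralReal u v hu hv
  rw [ProbabilityTheory.beta] at h
  have h2 : Complex.betaIntegral u v =
      ((∫ x in (0 : ℝ)..1, x ^ (u - 1) * (1 - x) ^ (v - 1) : ℝ) : ℂ) := by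
    rw [Complex.betaIntegral, ← intervalIntegral.integral_ofReal]
    refine intervalIntegral.integral_congr fun x hx => ?_
    rw [Set.uIcc_of_le zero_le_one] at hx
    push_cast
    rw [Complex.ofReal_cpow hx.1, Complex.ofReal_cpow (sub_nonneg.mpr hx.2)]
    push_cast
    rfl
  rw [h, h2, Complex.ofReal_re]

theorem integral_jacobi_weight {a b : ℝ} (ha : -1 < a) (hb : -1 < b) :
    ∫ x in (-1 : ℝ)..1, (1 - x) ^ a * (1 + x) ^ b =
      2 ^ (a + b + 1) * (Real.Gamma (a + 1) * Real.Gamma (b + 1) / Real.Gamma (a + b + 2)) := by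
  have h := intervalIntegral.smul_integral_comp_sub_mul
    (a := 0) (b := 1) (fun x : ℝ => (1 - x) ^ a * (1 + x) ^ b) 2 1
  norm_num at h
  rw [← h]
  have h2 := integral_rpow_mul_one_sub_rpow (u := a + 1) (v := b + 1) (by linarith) (by linarith)
  rw [show a + 1 + (b + 1) = a + b + 2 by ring] at h2
  rw [← h2, ← intervalIntegral.integral_const_mul, ← intervalIntegral.integral_const_mul]
  refine intervalIntegral.integral_congr fun x hx => ?_
  rw [Set.uIcc_of_le zero_le_one] at hx
  simp only [add_sub_cancel_right]
  rw [show 1 + (1 - 2 * x) = 2 * (1 - x) by ring, Real.mul_rpow two_pos.le hx.1,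
    Real.mul_rpow two_pos.le (sub_nonneg.mpr hx.2), Real.rpow_add two_pos, Real.rpow_add two_pos,
    Real.rpow_one]
  ring

/-- The integral of a non-integrable function is 0 by convention, whereas the closed form is
positive. -/
theorem intervalIntegrable_jacobi_weight {a b : ℝ} (ha : -1 < a) (hb : -1 < b) :
    IntervalIntegrable (fun x : ℝ => (1 - x) ^ a * (1 + x) ^ b) MeasureTheory.volume (-1) 1 := by
  by_contra hI
  have h := intervalIntegral.integral_undef hI
  rw [integral_jacobi_weight ha hb] at h
  have h1 := Real.Gamma_pos_of_pos (show 0 < a + 1 by linarith)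
  have h2 := Real.Gamma_pos_of_pos (show 0 < b + 1 by linarith)
  have h3 := Real.Gamma_pos_of_pos (show 0 < a + b + 2 by linarith)
  have : 0 < (2 : ℝ) ^ (a + b + 1) * (Real.Gamma (a + 1) * Real.Gamma (b + 1) /
    Real.Gamma (a + b + 2)) := by positivity
  linarith

/-- Integration of polynomials against the Jacobi weight. -/
noncomputable def jacobiFunctional {α β : ℝ} (hα : -1 < α) (hβ : -1 < β) : ℝ[X] →ₗ[ℝ] ℝ where
  toFun p := ∫ x in (-1 : ℝ)..1, p.eval x * ((1 - x) ^ α * (1 + x) ^ β)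
  map_add' p q := by
    have hi : ∀ p : ℝ[X], IntervalIntegrable (fun x : ℝ => p.eval x * ((1 - x) ^ α * (1 + x) ^ β))
        MeasureTheory.volume (-1) 1 := fun p =>
      (intervalIntegrable_jacobi_weight hα hβ).continuousOn_mul p.continuous.continuousOn
    rw [← intervalIntegral.integral_add (hi p) (hi q)]
    simp only [eval_add, add_mul]
  map_smul' c p := by
    simp only [eval_smul, smul_eq_mul, RingHom.id_apply, mul_assoc,
      intervalIntegral.integral_const_mul]

variable {α β : ℝ}

theorem sobolevInner_eq (hα : -1 < α) (hβ : -1 < β) (j : ℕ) (m : ℝ) (f g : ℝ[X]) :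
    sobolevInner α β j m f g = jacobiFunctional hα hβ (f * g) +
      m * (derivative^[j] f).eval 1 * (derivative^[j] g).eval 1 := by
  simp only [sobolevInner, jacobiFunctional, LinearMap.coe_mk, AddHom.coe_mk, eval_mul, mul_assoc]

theorem jacobiFunctional_one_sub_X_pow (hα : -1 < α) (hβ : -1 < β) (s : ℕ) :
    jacobiFunctional hα hβ ((1 - X) ^ s) = 2 ^ (α + β + 1) * 2 ^ s *
      (Real.Gamma (α + s + 1) * Real.Gamma (β + 1) / Real.Gamma (α + β + s + 2)) := by
  have hs : (0 : ℝ) ≤ s := s.cast_nonneg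
  have h := integral_jacobi_weight (a := α + s) (b := β) (by linarith) hβ
  rw [show α + s + β + 1 = α + β + 1 + s by ring, show α + s + β + 2 = α + β + s + 2 by ring,
    Real.rpow_add two_pos, Real.rpow_natCast] at h
  rw [← h]
  simp only [jacobiFunctional, LinearMap.coe_mk, AddHom.coe_mk]
  refine intervalIntegral.integral_congr fun x hx => ?_
  rw [Set.uIcc_of_le (by norm_num)] at hx
  simp only [eval_pow, eval_sub, eval_one, eval_X]
  have hx0 : 0 ≤ 1 - x := by linarith [hx.2]
  -- At x = 1 the base 1 - x is 0, and splitting the power requires α + s ≠ 0. This is automatic for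
  -- s ≥ 1, and for s = 0 there is nothing to split.
  rcases Nat.eq_zero_or_pos s with rfl | hpos
  · simp
  · have h1 : (1 : ℝ) ≤ s := by exact_mod_cast hpos
    rw [Real.rpow_add' hx0 (by linarith), Real.rpow_natCast]
    ring

/-! ### Taylor coefficients, orthogonality and norms of Jacobi polynomials. -/

/-- The `i`-th Taylor coefficient at `1` of the Jacobi polynomial of degree `n`. -/
noncomputable def jacobiTaylor (α β : ℝ) (n i : ℕ) : ℝ :=
  (n.choose i : ℝ) * (ascPochhammer ℝ i).eval ((n : ℝ) + α + β + 1) *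
    (ascPochhammer ℝ (n - i)).eval (α + (i : ℝ) + 1) / (n.factorial : ℝ) / 2 ^ i

theorem jacobiPoly_eq_sum (α β : ℝ) (n : ℕ) :
    jacobiPoly α β n = ∑ k ∈ Finset.range (n + 1), C (jacobiTaylor α β n k) * (X - 1) ^ k := by
  refine Finset.sum_congr rfl fun k _ => ?_
  rw [jacobiTaylor, mul_pow, ← mul_assoc, ← C_pow, ← C_mul]
  congr 2
  rw [one_div, inv_pow]
  rfl

theorem taylor_jacobiPoly_coeff (α β : ℝ) (n i : ℕ) :
    (taylor 1 (jacobiPoly α β n)).coeff i = jacobiTaylor α β n i := by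
  have h : taylor 1 (jacobiPoly α β n) =
      ∑ k ∈ Finset.range (n + 1), C (jacobiTaylor α β n k) * X ^ k := by
    rw [jacobiPoly_eq_sum, map_sum]
    refine Finset.sum_congr rfl fun k _ => ?_
    rw [taylor_mul, taylor_pow, taylor_C, map_sub, taylor_X, taylor_one]
    simp
  rw [h, finsetSum_coeff]
  simp only [coeff_C_mul, coeff_X_pow, mul_ite, mul_one, mul_zero, Finset.sum_ite_eq,
    Finset.mem_range]
  split_ifs with hi
  · rfl
  · rw [jacobiTaylor, Nat.choose_eq_zero_of_lt (by omega)]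
    simp

theorem jacobiTaylor_self_pos (hα : -1 < α) (hβ : -1 < β) (n : ℕ) : 0 < jacobiTaylor α β n n := by
  have hn : 0 < (ascPochhammer ℝ n).eval ((n : ℝ) + α + β + 1) := by
    rcases Nat.eq_zero_or_pos n with rfl | h
    · simp
    · have : (1 : ℝ) ≤ n := by exact_mod_cast h
      exact ascPochhammer_pos _ _ (by linarith)
  simp only [jacobiTaylor, Nat.choose_self, Nat.sub_self, ascPochhammer_zero, eval_one]
  positivity

theorem natDegree_jacobiPoly (hα : -1 < α) (hβ : -1 < β) (n : ℕ) :
    (jacobiPoly α β n).natDegree = n := by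
  rw [← natDegree_taylor _ (1 : ℝ)]
  refine natDegree_eq_of_le_of_coeff_ne_zero (natDegree_le_iff_coeff_eq_zero.mpr fun N hN => ?_) ?_
  · rw [taylor_jacobiPoly_coeff, jacobiTaylor, Nat.choose_eq_zero_of_lt hN]
    simp
  · rw [taylor_jacobiPoly_coeff]
    exact (jacobiTaylor_self_pos hα hβ n).ne'

theorem degree_jacobiPoly (hα : -1 < α) (hβ : -1 < β) (n : ℕ) :
    (jacobiPoly α β n).degree = n := by
  have h : jacobiPoly α β n ≠ 0 := by
    intro h
    have := taylor_jacobiPoly_coeff α β n n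
    rw [h] at this
    simp only [map_zero, coeff_zero] at this
    exact (jacobiTaylor_self_pos hα hβ n).ne this
  rw [degree_eq_natDegree h, natDegree_jacobiPoly hα hβ]

/-- Expanding at 1 gives X - 1 = -(1 - X), hence the alternating signs, and every term is a moment
of the weight. The bound n ≥ 1 makes n+α+β+1 positive, so that rising factorials can be written as
Gamma quotients. -/
theorem jacobiFunctional_jacobiPoly_mul_one_sub_X_pow_eq_sum (hα : -1 < α) (hβ : -1 < β) {n : ℕ}
    (hn : 1 ≤ n) (s : ℕ) :
    jacobiFunctional hα hβ (jacobiPoly α β n * (1 - X) ^ s) =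
      2 ^ (α + β + 1) * 2 ^ s * Real.Gamma (β + 1) * Real.Gamma (α + n + 1) /
        (n.factorial * Real.Gamma (n + α + β + 1)) *
      ∑ k ∈ Finset.range (n + 1), (-1) ^ k * (n.choose k : ℝ) *
        (Real.Gamma (n + α + β + 1 + k) * (ascPochhammer ℝ s).eval (α + k + 1) /
          Real.Gamma (α + β + s + k + 2)) := by
  have hn1 : (1 : ℝ) ≤ n := by exact_mod_cast hn
  rw [jacobiPoly_eq_sum, Finset.sum_mul, map_sum, Finset.mul_sum]
  refine Finset.sum_congr rfl fun k hk => ?_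
  have hkn : k ≤ n := Nat.lt_succ_iff.mp (Finset.mem_range.mp hk)
  have hk0 : (0 : ℝ) ≤ k := k.cast_nonneg
  have hX : C (jacobiTaylor α β n k) * (X - 1) ^ k * (1 - X) ^ s =
      (jacobiTaylor α β n k * (-1) ^ k) • (1 - X : ℝ[X]) ^ (s + k) := by
    rw [smul_eq_C_mul, C_mul, C_pow, show (X - 1 : ℝ[X]) = C (-1) * (1 - X) by simp, mul_pow]
    ring
  rw [hX, map_smul, jacobiFunctional_one_sub_X_pow, smul_eq_mul, jacobiTaylor]
  have g1 := Gamma_add_natCast (x := n + α + β + 1) (by linarith) k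
  have g2 := Gamma_add_natCast (x := α + k + 1) (by linarith) (n - k)
  have g3 := Gamma_add_natCast (x := α + k + 1) (by linarith) s
  rw [Nat.cast_sub hkn, show α + k + 1 + ((n : ℝ) - k) = α + n + 1 by ring] at g2
  have p0 := Real.Gamma_pos_of_pos (show 0 < (n : ℝ) + α + β + 1 by linarith)
  have p1 := Real.Gamma_pos_of_pos (show 0 < α + k + 1 by linarith)
  have p2 := Real.Gamma_pos_of_pos (show 0 < α + β + s + k + 2 by
    have : (0 : ℝ) ≤ s := s.cast_nonneg
    linarith)
  push_cast
  rw [show α + (s + k) + 1 = α + k + 1 + s by ring, show α + β + (s + k) + 2 = α + β + s + k + 2 by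
    ring, g1, g2, g3, pow_add]
  field_simp

/-- For s < n the Gamma quotient is a rising factorial of length n-1-s in k. The summand is then a
polynomial in k of degree n-1, annihilated by the n-th difference. -/
theorem jacobiFunctional_jacobiPoly_mul_one_sub_X_pow_of_lt (hα : -1 < α) (hβ : -1 < β) {n s : ℕ}
    (hs : s < n) :
    jacobiFunctional hα hβ (jacobiPoly α β n * (1 - X) ^ s) = 0 := by
  rw [jacobiFunctional_jacobiPoly_mul_one_sub_X_pow_eq_sum hα hβ (by omega)]
  have hdeg : (((ascPochhammer ℝ s).comp (X + C (α + 1))) *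
      ((ascPochhammer ℝ (n - 1 - s)).comp (X + C (α + β + s + 2)))).natDegree < n := by
    refine natDegree_mul_le.trans_lt ?_
    rw [natDegree_comp, natDegree_comp, natDegree_X_add_C, natDegree_X_add_C,
      ascPochhammer_natDegree, ascPochhammer_natDegree]
    omega
  refine mul_eq_zero_of_right _ ((alternating_sum_polynomial_eq_zero _ n hdeg).symm.trans ?_).symm
  refine Finset.sum_congr rfl fun k _ => ?_
  have hk0 : (0 : ℝ) ≤ k := k.cast_nonneg
  have hs0 : (0 : ℝ) ≤ s := s.cast_nonneg
  have hpos : 0 < α + β + s + k + 2 := by linarith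
  have g1 := Gamma_add_natCast hpos (n - 1 - s)
  obtain ⟨l, rfl⟩ := Nat.exists_eq_add_of_lt hs
  have hl : s + l + 1 - 1 - s = l := by omega
  rw [hl] at g1 ⊢
  rw [show α + β + s + k + 2 + (l : ℝ) = ((s + l + 1 : ℕ) : ℝ) + α + β + 1 + k by push_cast; ring]
    at g1
  rw [g1]
  have p2 := Real.Gamma_pos_of_pos hpos
  simp only [eval_mul, eval_comp, eval_add, eval_X, eval_C]
  rw [show (k : ℝ) + (α + 1) = α + k + 1 by ring,
    show (k : ℝ) + (α + β + s + 2) = α + β + s + k + 2 by ring]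
  field_simp

/-- At s = n the Gamma quotient degenerates to the simple pole 1/(n+α+β+1+k), and the sum is
evaluated at that pole. -/
theorem jacobiFunctional_jacobiPoly_mul_one_sub_X_pow_self (hα : -1 < α) (hβ : -1 < β) {n : ℕ}
    (hn : 1 ≤ n) :
    jacobiFunctional hα hβ (jacobiPoly α β n * (1 - X) ^ n) =
      (-1) ^ n * 2 ^ (α + β + 1) * 2 ^ n * Real.Gamma (α + n + 1) * Real.Gamma (β + n + 1) /
        Real.Gamma (2 * n + α + β + 2) := by
  have hn1 : (1 : ℝ) ≤ n := by exact_mod_cast hn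
  rw [jacobiFunctional_jacobiPoly_mul_one_sub_X_pow_eq_sum hα hβ hn]
  have hc : 0 < (n : ℝ) + α + β + 1 := by linarith
  have hdeg : ((ascPochhammer ℝ n).comp (X + C (α + 1))).natDegree ≤ n := by
    rw [natDegree_comp, natDegree_X_add_C, ascPochhammer_natDegree, mul_one]
  have hsum : ∑ k ∈ Finset.range (n + 1), (-1) ^ k * (n.choose k : ℝ) *
        (Real.Gamma (n + α + β + 1 + k) * (ascPochhammer ℝ n).eval (α + k + 1) /
          Real.Gamma (α + β + n + k + 2)) =
      ((ascPochhammer ℝ n).comp (X + C (α + 1))).eval (-((n : ℝ) + α + β + 1)) *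
        (n.factorial / (ascPochhammer ℝ (n + 1)).eval ((n : ℝ) + α + β + 1)) := by
    rw [← alternating_sum_polynomial_div _ n hdeg hc]
    refine Finset.sum_congr rfl fun k _ => ?_
    have hk0 : (0 : ℝ) ≤ k := k.cast_nonneg
    have hne : 0 < (n : ℝ) + α + β + 1 + k := by linarith
    have p := Real.Gamma_pos_of_pos hne
    rw [show α + β + n + k + 2 = (n : ℝ) + α + β + 1 + k + 1 by ring, Real.Gamma_add_one hne.ne']
    simp only [eval_comp, eval_add, eval_X, eval_C]
    rw [show (k : ℝ) + (α + 1) = α + k + 1 by ring]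
    field_simp
  rw [hsum]
  simp only [eval_comp, eval_add, eval_X, eval_C]
  have g1 := Gamma_add_natCast hc (n + 1)
  have g2 := Gamma_add_natCast (show 0 < β + 1 by linarith) n
  have hneg : (ascPochhammer ℝ n).eval (-((n : ℝ) + α + β + 1) + (α + 1)) =
      (-1) ^ n * (ascPochhammer ℝ n).eval (β + 1) := by
    rw [show -((n : ℝ) + α + β + 1) + (α + 1) = -(β + n) by ring,
      ascPochhammer_eval_neg_eq_descPochhammer, descPochhammer_eval_eq_ascPochhammer]
    congr 3
    ring
  push_cast at g1
  rw [hneg, show β + n + 1 = β + 1 + n by ring, g2,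
    show 2 * (n : ℝ) + α + β + 2 = n + α + β + 1 + (n + 1) by ring, g1]
  have p1 := Real.Gamma_pos_of_pos hc
  have p2 := ascPochhammer_pos (n + 1) _ hc
  field_simp

theorem jacobiFunctional_jacobiPoly_mul_of_degree_lt (hα : -1 < α) (hβ : -1 < β) {n : ℕ}
    {p : ℝ[X]} (hp : p.degree < n) :
    jacobiFunctional hα hβ (jacobiPoly α β n * p) = 0 := by
  by_cases hp0 : p = 0
  · simp [hp0]
  have hlt : (taylor 1 p).natDegree < n := by
    rwa [natDegree_taylor, natDegree_lt_iff_degree_lt hp0]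
  have h : p = ∑ s ∈ Finset.range n, C ((taylor 1 p).coeff s * (-1) ^ s) * (1 - X) ^ s := by
    apply taylor_injective (1 : ℝ)
    refine ((taylor 1 p).as_sum_range_C_mul_X_pow' hlt).trans ?_
    rw [map_sum]
    refine Finset.sum_congr rfl fun k _ => ?_
    rw [taylor_mul, taylor_pow, taylor_C, map_sub, taylor_X, taylor_one, C_1,
      show (1 - (X + 1) : ℝ[X]) = C (-1) * X by simp, mul_pow, C_mul, C_pow, mul_assoc,
      ← mul_assoc _ _ (X ^ k), ← mul_pow]
    simp
  rw [h, Finset.mul_sum, map_sum]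
  refine Finset.sum_eq_zero fun s hs => ?_
  rw [mul_left_comm, ← smul_eq_C_mul, map_smul,
    jacobiFunctional_jacobiPoly_mul_one_sub_X_pow_of_lt hα hβ (Finset.mem_range.mp hs), smul_zero]

/-- The squared norm of the Jacobi polynomial of degree `n`. -/
noncomputable def jacobiNormSq (hα : -1 < α) (hβ : -1 < β) (n : ℕ) : ℝ :=
  jacobiFunctional hα hβ (jacobiPoly α β n * jacobiPoly α β n)

/-- By orthogonality only the top Taylor term of one factor contributes. The case n = 0 is excluded
because α+β+1 may be 0 there. -/
theorem jacobiNormSq_eq (hα : -1 < α) (hβ : -1 < β) {n : ℕ} (hn : 1 ≤ n) :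
    jacobiNormSq hα hβ n = 2 ^ (α + β + 1) * Real.Gamma (α + n + 1) * Real.Gamma (β + n + 1) /
      ((2 * n + α + β + 1) * n.factorial * Real.Gamma (n + α + β + 1)) := by
  have hn1 : (1 : ℝ) ≤ n := by exact_mod_cast hn
  have hX : ∀ k, jacobiFunctional hα hβ (jacobiPoly α β n *
      (C (jacobiTaylor α β n k) * (X - 1) ^ k)) =
      jacobiTaylor α β n k * (-1) ^ k * jacobiFunctional hα hβ (jacobiPoly α β n * (1 - X) ^ k) := by
    intro k
    rw [← smul_eq_mul (jacobiTaylor α β n k * _), ← map_smul, smul_eq_C_mul, C_mul, C_pow,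
      show (X - 1 : ℝ[X]) = C (-1) * (1 - X) by simp, mul_pow]
    congr 1
    ring
  have hexp : jacobiNormSq hα hβ n = ∑ k ∈ Finset.range (n + 1), jacobiFunctional hα hβ
      (jacobiPoly α β n * (C (jacobiTaylor α β n k) * (X - 1) ^ k)) := by
    rw [← map_sum, ← Finset.mul_sum, ← jacobiPoly_eq_sum]
    rfl
  rw [hexp, Finset.sum_range_succ, Finset.sum_eq_zero, zero_add, hX,
    jacobiFunctional_jacobiPoly_mul_one_sub_X_pow_self hα hβ hn, jacobiTaylor]
  · have hc : 0 < (n : ℝ) + α + β + 1 := by linarith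
    have hc2 : 0 < 2 * (n : ℝ) + α + β + 1 := by linarith
    have g := Gamma_add_natCast hc n
    have g2 := Real.Gamma_add_one hc2.ne'
    rw [show (n : ℝ) + α + β + 1 + n = 2 * n + α + β + 1 by ring] at g
    rw [show 2 * (n : ℝ) + α + β + 1 + 1 = 2 * n + α + β + 2 by ring, g] at g2
    have p1 := Real.Gamma_pos_of_pos hc
    have p2 := ascPochhammer_pos n _ hc
    have h1 : ((-1 : ℝ) ^ n) * (-1) ^ n = 1 := by rw [← mul_pow]; norm_num
    rw [g2]
    simp only [Nat.choose_self, Nat.sub_self, ascPochhammer_zero, eval_one, Nat.cast_one]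
    field_simp
    linear_combination (Real.Gamma (α + n + 1) * Real.Gamma (β + n + 1) *
      (2 * (n : ℝ) + α + β + 1)⁻¹) * h1
  · intro k hk
    rw [hX, jacobiFunctional_jacobiPoly_mul_one_sub_X_pow_of_lt hα hβ (Finset.mem_range.mp hk),
      mul_zero]

theorem jacobiNormSq_pos (hα : -1 < α) (hβ : -1 < β) (n : ℕ) : 0 < jacobiNormSq hα hβ n := by
  rcases Nat.eq_zero_or_pos n with rfl | hn
  · have h := jacobiFunctional_one_sub_X_pow hα hβ 0
    have hP : jacobiPoly α β 0 = 1 := by simp [jacobiPoly]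
    rw [jacobiNormSq, hP, mul_one, ← pow_zero (1 - X : ℝ[X]), h]
    have p1 := Real.Gamma_pos_of_pos (show 0 < α + (0 : ℕ) + 1 by simp; linarith)
    have p2 := Real.Gamma_pos_of_pos (show 0 < β + 1 by linarith)
    have p3 := Real.Gamma_pos_of_pos (show 0 < α + β + (0 : ℕ) + 2 by simp; linarith)
    positivity
  · have hn1 : (1 : ℝ) ≤ n := by exact_mod_cast hn
    rw [jacobiNormSq_eq hα hβ hn]
    have p1 := Real.Gamma_pos_of_pos (show 0 < α + n + 1 by linarith)
    have p2 := Real.Gamma_pos_of_pos (show 0 < β + n + 1 by linarith)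
    have p3 := Real.Gamma_pos_of_pos (show 0 < (n : ℝ) + α + β + 1 by linarith)
    have p4 : 0 < 2 * (n : ℝ) + α + β + 1 := by linarith
    positivity

theorem jacobiFunctional_jacobiPoly_mul_jacobiPoly_of_ne (hα : -1 < α) (hβ : -1 < β) {k l : ℕ}
    (h : k ≠ l) : jacobiFunctional hα hβ (jacobiPoly α β k * jacobiPoly α β l) = 0 := by
  rcases lt_or_gt_of_ne h with h | h
  · rw [mul_comm]
    apply jacobiFunctional_jacobiPoly_mul_of_degree_lt
    rw [degree_jacobiPoly hα hβ]
    exact_mod_cast h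
  · apply jacobiFunctional_jacobiPoly_mul_of_degree_lt
    rw [degree_jacobiPoly hα hβ]
    exact_mod_cast h

/-- Expansion of a polynomial in the orthogonal basis of Jacobi polynomials. -/
theorem eq_sum_jacobiPoly (hα : -1 < α) (hβ : -1 < β) {n : ℕ} {p : ℝ[X]} (hp : p.degree < n) :
    p = ∑ k ∈ Finset.range n,
      (jacobiFunctional hα hβ (p * jacobiPoly α β k) / jacobiNormSq hα hβ k) • jacobiPoly α β k := by
  let S : Polynomial.Sequence ℝ := ⟨jacobiPoly α β, degree_jacobiPoly hα hβ⟩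
  have hmem : p ∈ Submodule.span ℝ (S '' Set.Iio n) := by
    rw [S.span_degreeLT fun i _ => (leadingCoeff_ne_zero.mpr (S.ne_zero i)).isUnit]
    exact mem_degreeLT.mpr hp
  induction hmem using Submodule.span_induction with
  | mem x hx =>
    obtain ⟨l, hl, rfl⟩ := hx
    rw [Finset.sum_eq_single l]
    · change jacobiPoly α β l = (jacobiNormSq hα hβ l / jacobiNormSq hα hβ l) • jacobiPoly α β l
      rw [div_self (jacobiNormSq_pos hα hβ l).ne', one_smul]
    · intro k _ hk
      change (jacobiFunctional hα hβ (jacobiPoly α β l * jacobiPoly α β k) / _) • _ = _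
      rw [jacobiFunctional_jacobiPoly_mul_jacobiPoly_of_ne hα hβ hk.symm, zero_div, zero_smul]
    · intro h
      exact absurd (Finset.mem_range.mpr hl) h
  | zero => simp
  | add x y hx hy ihx ihy =>
    have hd : ∀ z ∈ Submodule.span ℝ (S '' Set.Iio n), z.degree < n := fun z hz => by
      rw [S.span_degreeLT fun i _ => (leadingCoeff_ne_zero.mpr (S.ne_zero i)).isUnit] at hz
      exact mem_degreeLT.mp hz
    simp only [add_mul, map_add, add_div, add_smul, Finset.sum_add_distrib]
    rw [← ihx (hd x hx), ← ihy (hd y hy)]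
  | smul a x hx ihx =>
    have hd : x.degree < n := by
      rw [S.span_degreeLT fun i _ => (leadingCoeff_ne_zero.mpr (S.ne_zero i)).isUnit] at hx
      exact mem_degreeLT.mp hx
    simp only [smul_mul_assoc, map_smul, smul_eq_mul, mul_div_assoc, mul_smul]
    rw [← Finset.smul_sum, ← ihx hd]

/-! ### The Sobolev polynomial as a kernel perturbation of the Jacobi polynomial. -/

theorem eval_iterate_derivative_one (j : ℕ) (p : ℝ[X]) :
    (derivative^[j] p).eval 1 = j.factorial * (taylor 1 p).coeff j := by
  rw [taylor_coeff, ← factorial_smul_hasseDeriv]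
  simp

/-- The `i`-th Taylor coefficient at `x = 1` of `j! ∂_y^j K_{n-1}(x, y)` at `y = 1`, where
`K_{n-1}` is the Christoffel–Darboux kernel of the Jacobi weight. -/
noncomputable def kernelTaylor (hα : -1 < α) (hβ : -1 < β) (j n i : ℕ) : ℝ :=
  ∑ k ∈ Finset.range n, jacobiTaylor α β k i *
    ((j.factorial : ℝ) ^ 2 * jacobiTaylor α β k j / jacobiNormSq hα hβ k)

/-- Testing orthogonality against each P_k with k < n gives the Jacobi coefficients of Q - P_n: they
equal -m Q^{(j)}(1) P_k^{(j)}(1) over the squared norm. The unknown on the right is fixed by taking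
i = j. -/
theorem taylor_coeff_eq_of_isJacobiSobolev (hα : -1 < α) (hβ : -1 < β) {j n : ℕ} {m : ℝ}
    {Q : ℝ[X]} (hQ : IsJacobiSobolev α β j m n Q) (i : ℕ) :
    (taylor 1 Q).coeff i =
      jacobiTaylor α β n i - m * (taylor 1 Q).coeff j * kernelTaylor hα hβ j n i := by
  have hQ0 : Q ≠ 0 := by
    intro h
    have h1 := hQ.leadingCoeff_eq
    rw [h, leadingCoeff_zero] at h1
    have h2 := leadingCoeff_eq_zero.mp h1.symm
    have h3 := degree_jacobiPoly hα hβ n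
    rw [h2, degree_zero] at h3
    exact absurd h3 (by simp)
  have hdegQ : Q.degree = n := by rw [degree_eq_natDegree hQ0, hQ.natDegree_eq]
  have hlt : (Q - jacobiPoly α β n).degree < n := by
    rw [← hdegQ]
    exact degree_sub_lt_left (by rw [hdegQ, degree_jacobiPoly hα hβ]) hQ0 hQ.leadingCoeff_eq
  have hcoef : ∀ k ∈ Finset.range n,
      jacobiFunctional hα hβ ((Q - jacobiPoly α β n) * jacobiPoly α β k) =
        -(m * (taylor 1 Q).coeff j * (j.factorial : ℝ) ^ 2 * jacobiTaylor α β k j) := by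
    intro k hk
    have hk' := Finset.mem_range.mp hk
    have h1 := hQ.orthogonal (jacobiPoly α β k) (by
      rw [degree_jacobiPoly hα hβ]; exact_mod_cast hk')
    rw [sobolevInner_eq hα hβ, eval_iterate_derivative_one, eval_iterate_derivative_one,
      taylor_jacobiPoly_coeff] at h1
    rw [sub_mul, map_sub, jacobiFunctional_jacobiPoly_mul_jacobiPoly_of_ne hα hβ hk'.ne']
    linear_combination h1
  have h := congrArg (fun p : ℝ[X] => (taylor 1 p).coeff i) (eq_sum_jacobiPoly hα hβ hlt)
  simp only [map_sub, coeff_sub, map_sum, map_smul, finsetSum_coeff, coeff_smul, smul_eq_mul,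
    taylor_jacobiPoly_coeff] at h
  rw [sub_eq_iff_eq_add'] at h
  rw [h, kernelTaylor, Finset.mul_sum, sub_eq_add_neg (jacobiTaylor α β n i),
    ← Finset.sum_neg_distrib]
  congr 1
  refine Finset.sum_congr rfl fun k hk => ?_
  rw [hcoef k hk]
  ring

/-! ### Power-law asymptotics of coefficients, norms and kernels. -/

theorem tendsto_natCast_add_div (c : ℝ) :
    Tendsto (fun n : ℕ => ((n : ℝ) + c) / n) atTop (𝓝 1) := by
  have h : Tendsto (fun n : ℕ => 1 + c / (n : ℝ)) atTop (𝓝 (1 + 0)) :=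
    tendsto_const_nhds.add (tendsto_const_div_atTop_nhds_zero_nat c)
  rw [add_zero] at h
  refine h.congr' ?_
  filter_upwards [eventually_gt_atTop 0] with n hn
  have : (n : ℝ) ≠ 0 := by positivity
  field_simp

/-- This is Gauss's product limit for Γ(a), inverted. -/
theorem tendsto_Gamma_div_of_pos {a : ℝ} (ha : 0 < a) :
    Tendsto (fun n : ℕ => Real.Gamma (n + a + 1) / (n.factorial * (n : ℝ) ^ a)) atTop (𝓝 1) := by
  have hΓ := Real.Gamma_pos_of_pos ha
  have h := ((Real.GammaSeq_tendsto_Gamma a).div_const (Real.Gamma a)).inv₀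
    (by rw [div_self hΓ.ne']; exact one_ne_zero)
  rw [div_self hΓ.ne', inv_one] at h
  refine h.congr' ?_
  filter_upwards [eventually_gt_atTop 0] with n hn
  have hn0 : (0 : ℝ) < n := by exact_mod_cast hn
  have hprod : ∀ n : ℕ, ∏ k ∈ Finset.range n, (a + (k : ℝ)) = (ascPochhammer ℝ n).eval a := by
    intro n
    induction n with
    | zero => simp
    | succ n ih => rw [Finset.prod_range_succ, ih, ascPochhammer_succ_eval]
  have g := Gamma_add_natCast ha (n + 1)
  rw [Real.GammaSeq, hprod, show (n : ℝ) + a + 1 = a + (n + 1 : ℕ) by push_cast; ring, g]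
  have p := ascPochhammer_pos (n + 1) a ha
  have p2 : 0 < (n : ℝ) ^ a := Real.rpow_pos_of_pos hn0 a
  field_simp

theorem tendsto_Gamma_div_of_add_one {a : ℝ}
    (h : Tendsto (fun n : ℕ => Real.Gamma (n + (a + 1) + 1) / (n.factorial * (n : ℝ) ^ (a + 1)))
      atTop (𝓝 1)) :
    Tendsto (fun n : ℕ => Real.Gamma (n + a + 1) / (n.factorial * (n : ℝ) ^ a)) atTop (𝓝 1) := by
  have h2 := h.div (tendsto_natCast_add_div (a + 1)) one_ne_zero
  rw [div_one] at h2
  refine h2.congr' ?_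
  filter_upwards [eventually_gt_atTop 0, (tendsto_natCast_atTop_atTop (R := ℝ)).eventually
    (eventually_gt_atTop (-(a + 1)))] with n hn hn2
  have hn0 : (0 : ℝ) < n := by exact_mod_cast hn
  have hne : (n : ℝ) + (a + 1) ≠ 0 := by linarith
  have p2 : 0 < (n : ℝ) ^ a := Real.rpow_pos_of_pos hn0 a
  simp only [Pi.div_apply]
  rw [Real.Gamma_add_one hne, Real.rpow_add_one hn0.ne', ← add_assoc (n : ℝ)]
  rw [← add_assoc] at hne
  field_simp

/-- Two downward shifts from the positive case. The range a > -2 is needed for a = α + β in the norm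
asymptotics. -/
theorem tendsto_Gamma_div {a : ℝ} (ha : -2 < a) :
    Tendsto (fun n : ℕ => Real.Gamma (n + a + 1) / (n.factorial * (n : ℝ) ^ a)) atTop (𝓝 1) :=
  tendsto_Gamma_div_of_add_one (tendsto_Gamma_div_of_add_one
    (tendsto_Gamma_div_of_pos (by linarith)))

theorem tendsto_ascPochhammer_div (c : ℝ) (i : ℕ) :
    Tendsto (fun n : ℕ => (ascPochhammer ℝ i).eval ((n : ℝ) + c) / (n : ℝ) ^ i) atTop (𝓝 1) := by
  induction i with
  | zero => simp
  | succ i ih =>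
    have h := ih.mul (tendsto_natCast_add_div (c + i))
    rw [mul_one] at h
    refine h.congr fun n => ?_
    rw [ascPochhammer_succ_eval, div_mul_div_comm, pow_succ, add_assoc]

theorem tendsto_choose_div (i : ℕ) :
    Tendsto (fun n : ℕ => (n.choose i : ℝ) / (n : ℝ) ^ i) atTop (𝓝 (1 / i.factorial)) := by
  have h : Tendsto (fun n : ℕ => (descPochhammer ℝ i).eval (n : ℝ) / (n : ℝ) ^ i) atTop (𝓝 1) := by
    induction i with
    | zero => simp
    | succ i ih =>
      have h := ih.mul (tendsto_natCast_add_div (-(i : ℝ)))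
      rw [mul_one] at h
      refine h.congr fun n => ?_
      rw [descPochhammer_succ_eval, div_mul_div_comm, pow_succ, sub_eq_add_neg]
  refine (h.div_const (i.factorial : ℝ)).congr fun n => ?_
  rw [Nat.cast_choose_eq_descPochhammer_div]
  ring

/-- The difference quotient of x^q at 1 with step 1/n. -/
theorem tendsto_rpow_sub_rpow_div (q : ℝ) :
    Tendsto (fun n : ℕ => (((n : ℝ) + 1) ^ q - (n : ℝ) ^ q) / (n : ℝ) ^ (q - 1)) atTop (𝓝 q) := by
  have h := (Real.hasDerivAt_rpow_const (x := 1) (p := q) (Or.inl one_ne_zero)).tendsto_slope_zero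
  have hinv : Tendsto (fun n : ℕ => ((n : ℝ))⁻¹) atTop (𝓝[≠] 0) := by
    refine tendsto_nhdsWithin_iff.mpr ⟨tendsto_inv_atTop_nhds_zero_nat, ?_⟩
    filter_upwards [eventually_gt_atTop 0] with n hn
    have : (n : ℝ) ≠ 0 := by positivity
    simpa using this
  have h2 := h.comp hinv
  rw [Real.one_rpow (q - 1), mul_one] at h2
  refine h2.congr' ?_
  filter_upwards [eventually_gt_atTop 0] with n hn
  have hn0 : (0 : ℝ) < n := by exact_mod_cast hn
  simp only [Function.comp_apply, inv_inv, smul_eq_mul, Real.one_rpow]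
  rw [show (n : ℝ) + 1 = n * (1 + (n : ℝ)⁻¹) by field_simp, Real.mul_rpow hn0.le (by positivity),
    Real.rpow_sub_one hn0.ne']
  have p2 : 0 < (n : ℝ) ^ q := Real.rpow_pos_of_pos hn0 q
  field_simp

/-- Summation of an asymptotic power law. -/
theorem tendsto_sum_range_div_rpow {a : ℕ → ℝ} {q A : ℝ} (hq : 0 < q)
    (ha : Tendsto (fun n : ℕ => a n / (n : ℝ) ^ (q - 1)) atTop (𝓝 A)) :
    Tendsto (fun n : ℕ => (∑ k ∈ Finset.range n, a k) / (n : ℝ) ^ q) atTop (𝓝 (A / q)) := by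
  -- Stolz–Cesàro: compare a with the increments of n^q, which are positive and telescope to n^q
  -- because 0^q = 0 for q > 0.
  set g : ℕ → ℝ := fun n => ((n : ℝ) + 1) ^ q - (n : ℝ) ^ q with hg
  have hgpos : ∀ n, 0 < g n := fun n =>
    sub_pos.mpr (Real.rpow_lt_rpow n.cast_nonneg (by linarith) hq)
  have hsum : ∀ n, ∑ k ∈ Finset.range n, g k = (n : ℝ) ^ q := by
    intro n
    have := Finset.sum_range_sub (fun k : ℕ => (k : ℝ) ^ q) n
    simpa [hg, Real.zero_rpow hq.ne'] using this
  have hlim : Tendsto (fun n => a n / g n) atTop (𝓝 (A / q)) := by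
    refine (ha.div (tendsto_rpow_sub_rpow_div q) hq.ne').congr' ?_
    filter_upwards [eventually_gt_atTop 0] with n hn
    have p2 : 0 < (n : ℝ) ^ (q - 1) := Real.rpow_pos_of_pos (by exact_mod_cast hn) _
    exact div_div_div_cancel_right₀ p2.ne' _ _
  have ho : (fun n => a n - A / q * g n) =o[atTop] g := by
    rw [Asymptotics.isLittleO_iff_tendsto' (.of_forall fun n h => absurd h (hgpos n).ne')]
    have := hlim.sub_const (A / q)
    rw [sub_self] at this
    refine this.congr fun n => ?_
    rw [sub_div, mul_div_cancel_right₀ _ (hgpos n).ne']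
  have hsumo := ho.sum_range (fun n => (hgpos n).le) (by
    simp_rw [hsum]
    exact (tendsto_rpow_atTop hq).comp tendsto_natCast_atTop_atTop)
  simp_rw [hsum, Finset.sum_sub_distrib, ← Finset.mul_sum, hsum] at hsumo
  have h0 := hsumo.tendsto_div_nhds_zero.add_const (A / q)
  rw [zero_add] at h0
  refine h0.congr' ?_
  filter_upwards [eventually_gt_atTop 0] with n hn
  have p2 : 0 < (n : ℝ) ^ q := Real.rpow_pos_of_pos (by exact_mod_cast hn) _
  field_simp
  ring

theorem jacobiTaylor_zero (hα : -1 < α) (β : ℝ) (n : ℕ) :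
    jacobiTaylor α β n 0 = Real.Gamma (n + α + 1) / n.factorial / Real.Gamma (α + 1) := by
  have hp : 0 < α + 1 := by linarith
  have g := Gamma_add_natCast hp n
  have p := Real.Gamma_pos_of_pos hp
  rw [show (n : ℝ) + α + 1 = α + 1 + n by ring, g, jacobiTaylor]
  simp
  field_simp

/-- Separates the factor carrying n^α, common to all i, from a factor polynomial in n. Both the
limits and the majorant use this splitting. -/
theorem jacobiTaylor_eq_mul (hα : -1 < α) (β : ℝ) (n i : ℕ) :
    jacobiTaylor α β n i = jacobiTaylor α β n 0 *
      ((n.choose i : ℝ) * (ascPochhammer ℝ i).eval ((n : ℝ) + (α + β + 1)) /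
        ((ascPochhammer ℝ i).eval (α + 1) * 2 ^ i)) := by
  rcases lt_or_ge n i with h | h
  · simp [jacobiTaylor, Nat.choose_eq_zero_of_lt h]
  obtain ⟨l, rfl⟩ := Nat.exists_eq_add_of_le h
  have p := ascPochhammer_pos i (α + 1) (by linarith)
  have hsplit := ascPochhammer_eval_add (α + 1) i l
  rw [show α + 1 + i = α + (i : ℝ) + 1 by ring] at hsplit
  simp only [jacobiTaylor, Nat.choose_zero_right, Nat.sub_zero, ascPochhammer_zero, eval_one,
    Nat.cast_zero, add_zero, pow_zero, hsplit, Nat.add_sub_cancel_left, ← add_assoc, Nat.cast_one]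
  field_simp

theorem tendsto_jacobiTaylor_zero_div (hα : -1 < α) (β : ℝ) :
    Tendsto (fun n : ℕ => jacobiTaylor α β n 0 / (n : ℝ) ^ α) atTop
      (𝓝 (1 / Real.Gamma (α + 1))) := by
  refine ((tendsto_Gamma_div (a := α) (by linarith)).div_const (Real.Gamma (α + 1))).congr
    fun n => ?_
  rw [jacobiTaylor_zero hα]
  ring

/-- The limit of `n ^ (-α - 2i)` times the `i`-th Taylor coefficient of the Jacobi polynomial. -/
noncomputable def taylorLimit (α : ℝ) (i : ℕ) : ℝ :=
  1 / (i.factorial * 2 ^ i * Real.Gamma (α + i + 1))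

theorem taylorLimit_pos (hα : -1 < α) (i : ℕ) : 0 < taylorLimit α i := by
  have := Real.Gamma_pos_of_pos (show 0 < α + i + 1 by
    have : (0 : ℝ) ≤ i := i.cast_nonneg
    linarith)
  rw [taylorLimit]
  positivity

theorem tendsto_jacobiTaylor_div (hα : -1 < α) (β : ℝ) (i : ℕ) :
    Tendsto (fun n : ℕ => jacobiTaylor α β n i / ((n : ℝ) ^ α * (n : ℝ) ^ (2 * i))) atTop
      (𝓝 (taylorLimit α i)) := by
  have hp : 0 < α + 1 := by linarith
  have p := ascPochhammer_pos i (α + 1) hp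
  have g := Gamma_add_natCast hp i
  have h := (tendsto_jacobiTaylor_zero_div hα β).mul
    (((tendsto_choose_div i).mul (tendsto_ascPochhammer_div (α + β + 1) i)).div_const
      ((ascPochhammer ℝ i).eval (α + 1) * 2 ^ i))
  have hL : 1 / Real.Gamma (α + 1) *
      (1 / (i.factorial : ℝ) * 1 / ((ascPochhammer ℝ i).eval (α + 1) * 2 ^ i)) =
      taylorLimit α i := by
    rw [taylorLimit, show α + i + 1 = α + 1 + i by ring, g]
    field_simp
  rw [hL] at h
  refine h.congr fun n => ?_
  rw [jacobiTaylor_eq_mul hα β n i, two_mul, pow_add]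
  simp only [div_eq_mul_inv, mul_inv]
  ring

theorem tendsto_jacobiNormSq (hα : -1 < α) (hβ : -1 < β) :
    Tendsto (fun n : ℕ => jacobiNormSq hα hβ n * n) atTop (𝓝 (2 ^ (α + β))) := by
  have h1 := tendsto_Gamma_div (a := α) (by linarith)
  have h2 := tendsto_Gamma_div (a := β) (by linarith)
  have h3 := tendsto_Gamma_div (a := α + β) (by linarith)
  have h4 := tendsto_natCast_add_div ((α + β + 1) / 2)
  have h := ((h1.mul h2).div (h3.mul h4) (by norm_num)).const_mul ((2 : ℝ) ^ (α + β))
  simp only [mul_one, div_one] at h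
  refine h.congr' ?_
  filter_upwards [eventually_ge_atTop 1] with n hn
  have hn1 : (1 : ℝ) ≤ n := by exact_mod_cast hn
  have hn0 : (0 : ℝ) < n := by linarith
  simp only [Pi.div_apply]
  rw [jacobiNormSq_eq hα hβ hn, Real.rpow_add_one two_ne_zero, Real.rpow_add hn0,
    show α + n + 1 = n + α + 1 by ring, show β + n + 1 = n + β + 1 by ring, ← add_assoc (n : ℝ) α]
  have p1 := Real.rpow_pos_of_pos hn0 α
  have p2 := Real.rpow_pos_of_pos hn0 β
  have p3 := Real.Gamma_pos_of_pos (show 0 < (n : ℝ) + α + β + 1 by linarith)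
  have p4 : 0 < 2 * (n : ℝ) + α + β + 1 := by linarith
  have e : (n : ℝ) + (α + β + 1) / 2 = (2 * n + α + β + 1) / 2 := by ring
  rw [e]
  field_simp

/-- The limit of `n ^ (-2α - 2i - 2j - 2)` times `kernelTaylor`. -/
noncomputable def kernelLimit (α β : ℝ) (j i : ℕ) : ℝ :=
  taylorLimit α i * ((j.factorial : ℝ) ^ 2 * taylorLimit α j / 2 ^ (α + β)) /
    (2 * (α + i + j + 1))

theorem tendsto_kernelTaylor_div (hα : -1 < α) (hβ : -1 < β) (j i : ℕ) :
    Tendsto (fun n : ℕ => kernelTaylor hα hβ j n i / (n : ℝ) ^ (2 * (α + i + j + 1))) atTop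
      (𝓝 (kernelLimit α β j i)) := by
  have hi0 : (0 : ℝ) ≤ i := i.cast_nonneg
  have hj0 : (0 : ℝ) ≤ j := j.cast_nonneg
  -- The summand has order α+2i from one Taylor coefficient, α+2j from the other and 1 from the
  -- inverse norm. The total is one less than the claimed exponent, which is positive.
  refine tendsto_sum_range_div_rpow (by linarith) ?_
  have h2 : (2 : ℝ) ^ (α + β) ≠ 0 := (Real.rpow_pos_of_pos two_pos _).ne'
  have h := (tendsto_jacobiTaylor_div hα β i).mul
    (((tendsto_jacobiTaylor_div hα β j).const_mul ((j.factorial : ℝ) ^ 2)).div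
      (tendsto_jacobiNormSq hα hβ) h2)
  refine h.congr' ?_
  filter_upwards [eventually_gt_atTop 0] with n hn
  have hn0 : (0 : ℝ) < n := by exact_mod_cast hn
  have e : (n : ℝ) ^ (2 * (α + i + j + 1) - 1) =
      (n : ℝ) ^ α * (n : ℝ) ^ (2 * i) * ((n : ℝ) ^ α * (n : ℝ) ^ (2 * j)) * n := by
    rw [← Real.rpow_natCast, ← Real.rpow_natCast, ← Real.rpow_add hn0, ← Real.rpow_add hn0,
      ← Real.rpow_add hn0, ← Real.rpow_add_one hn0.ne']
    congr 1
    push_cast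
    ring
  simp only [Pi.div_apply]
  rw [e]
  have p1 := Real.rpow_pos_of_pos hn0 α
  have p2 := jacobiNormSq_pos hα hβ n
  field_simp

/-- The kernel limit enters the final coefficient only through this product; relative to
`taylorLimit α i` it gives the explicit dependence of r_i on i. -/
theorem kernelLimit_eq (hα : -1 < α) (β : ℝ) (j i : ℕ) :
    taylorLimit α j * kernelLimit α β j i =
      taylorLimit α i * ((α + 2 * j + 1) / (criticalMass α β j * (α + j + i + 1))) := by
  have hi0 : (0 : ℝ) ≤ i := i.cast_nonneg
  have hj0 : (0 : ℝ) ≤ j := j.cast_nonneg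
  have p1 := Real.Gamma_pos_of_pos (show 0 < α + j + 1 by linarith)
  have p2 : 0 < α + 2 * j + 1 := by linarith
  have p3 : 0 < α + j + i + 1 := by linarith
  have p4 : (0 : ℝ) < 2 ^ (α + β) := Real.rpow_pos_of_pos two_pos _
  have e : (2 : ℝ) ^ (α + β + 2 * j + 1) = 2 ^ (α + β) * 2 ^ j * 2 ^ j * 2 := by
    rw [Real.rpow_add_one two_ne_zero, Real.rpow_add two_pos, two_mul, Real.rpow_add two_pos (j : ℝ),
      Real.rpow_natCast]
    ring
  rw [kernelLimit, criticalMass, e, show α + i + j + 1 = α + j + i + 1 by ring]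
  simp only [show taylorLimit α j = 1 / (j.factorial * 2 ^ j * Real.Gamma (α + j + 1)) from rfl]
  rw [mul_comm 2 (j : ℝ)] at *
  field_simp

theorem kernelLimit_self (hα : -1 < α) (β : ℝ) (j : ℕ) :
    kernelLimit α β j j = 1 / criticalMass α β j := by
  have h := kernelLimit_eq hα β j j
  have p := taylorLimit_pos hα j
  have hj0 : (0 : ℝ) ≤ j := j.cast_nonneg
  have p2 : 0 < α + 2 * j + 1 := by linarith
  have h' := mul_left_cancel₀ p.ne' h
  rw [h', show α + j + j + 1 = α + 2 * j + 1 by ring]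
  field_simp

theorem criticalMass_pos (hα : -1 < α) (β : ℝ) (j : ℕ) : 0 < criticalMass α β j := by
  have hj0 : (0 : ℝ) ≤ j := j.cast_nonneg
  have p1 := Real.Gamma_pos_of_pos (show 0 < α + j + 1 by linarith)
  have p2 : 0 < α + 2 * j + 1 := by linarith
  have p4 : (0 : ℝ) < 2 ^ (α + β + 2 * j + 1) := Real.rpow_pos_of_pos two_pos _
  rw [criticalMass]
  positivity

/-! ### Power series of Bessel combinations and termination of the recursion. -/

theorem min_one_le_ascPochhammer {a : ℝ} (ha : 0 < a) (i : ℕ) :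
    min 1 a ≤ (ascPochhammer ℝ i).eval a := by
  induction i with
  | zero => simp
  | succ i ih =>
    rcases Nat.eq_zero_or_pos i with rfl | hi
    · simp
    · have h1 : (1 : ℝ) ≤ i := by exact_mod_cast hi
      rw [ascPochhammer_succ_eval]
      exact ih.trans (le_mul_of_one_le_right (ascPochhammer_pos i a ha).le (by linarith))

theorem summable_pow_div_factorial_mul_ascPochhammer {a : ℝ} (ha : 0 < a) (x : ℝ) :
    Summable fun i : ℕ => x ^ i / (i.factorial * (ascPochhammer ℝ i).eval a) := by
  have hmin : 0 < min 1 a := lt_min one_pos ha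
  refine Summable.of_norm_bounded ((Real.summable_pow_div_factorial |x|).div_const (min 1 a))
    fun i => ?_
  have hp := ascPochhammer_pos i a ha
  rw [Real.norm_eq_abs, abs_div, abs_pow, abs_of_pos (by positivity : (0 : ℝ) < i.factorial * _),
    div_div]
  have := min_one_le_ascPochhammer ha i
  gcongr

/-- The recursion is this triangular system solved for its diagonal term k = s. -/
theorem eq_sum_besselCoeff (hα : -1 < α) (r : ℕ → ℝ) (s : ℕ) :
    r s = Real.Gamma (α + s + 1) * ∑ k ∈ Finset.range (s + 1), besselCoeff α r k *
      (s.choose k : ℝ) * ((-1) ^ k * (k.factorial : ℝ) * 2 ^ k) / Real.Gamma (α + s + k + 1) := by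
  have hs0 : (0 : ℝ) ≤ s := s.cast_nonneg
  have p1 := Real.Gamma_pos_of_pos (show 0 < α + s + 1 by linarith)
  have p2 := Real.Gamma_pos_of_pos (show 0 < α + 2 * s + 1 by linarith)
  have h1 : ((-1 : ℝ) ^ s) * (-1) ^ s = 1 := by rw [← mul_pow]; norm_num
  rw [Finset.sum_range_succ, mul_add, show α + s + s + 1 = α + 2 * s + 1 by ring]
  have hb := besselCoeff.eq_def α r s
  rw [Fin.sum_univ_eq_sum_range (fun k => besselCoeff α r k * (s.choose k : ℝ) *
    ((-1) ^ k * (k.factorial : ℝ) * 2 ^ k) / Real.Gamma (α + s + k + 1)) s] at hb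
  rw [hb, Nat.choose_self, Nat.cast_one]
  generalize Real.Gamma (α + 2 * s + 1) = G at p2 ⊢
  generalize Real.Gamma (α + s + 1) = G' at p1 ⊢
  generalize ∑ k ∈ Finset.range s, besselCoeff α r k * (s.choose k : ℝ) *
    ((-1) ^ k * (k.factorial : ℝ) * 2 ^ k) / Real.Gamma (α + s + k + 1) = S
  field_simp
  linear_combination (G' * S - r s) * h1

/-- If `r i (α + j + i + 1)` is affine in `i`, the recursion for the coefficients terminates: the
first `j + 2` of them represent `r` at every index. -/
theorem eq_sum_besselCoeff_range (hα : -1 < α) (j : ℕ) {r : ℕ → ℝ} {u v : ℝ}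
    (hr : ∀ i : ℕ, r i * (α + j + i + 1) = u * i + v) (s : ℕ) :
    r s = Real.Gamma (α + s + 1) * ∑ k ∈ Finset.range (j + 2), besselCoeff α r k *
      (s.choose k : ℝ) * ((-1) ^ k * (k.factorial : ℝ) * 2 ^ k) / Real.Gamma (α + s + k + 1) := by
  set b := besselCoeff α r with hb
  set F : ℕ → ℝ := fun s => Real.Gamma (α + s + 1) * ∑ k ∈ Finset.range (j + 2), b k *
      (s.choose k : ℝ) * ((-1) ^ k * (k.factorial : ℝ) * 2 ^ k) / Real.Gamma (α + s + k + 1) with hF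
  change r s = F s
  -- For s ≤ j+1 the terms with k > s carry a vanishing binomial, so truncation at j+1 loses
  -- nothing.
  have hsmall : ∀ s ≤ j + 1, r s = F s := by
    intro s hs
    rw [eq_sum_besselCoeff hα r s, hF]
    congr 1
    refine Finset.sum_subset (Finset.range_mono (by omega)) fun k _ hk => ?_
    rw [Nat.choose_eq_zero_of_lt (by simpa using hk)]
    simp
  -- The defect F(s) - r(s) multiplied by (α+1+s)_{j+1}. That factor clears every Gamma quotient,
  -- and its last factor α+1+s+j turns r(s) into the affine function us + v. The result has degree
  -- at most j+1.
  set p : ℝ[X] := (∑ k ∈ Finset.range (j + 2), C (b k * ((-1) ^ k * 2 ^ k)) *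
    (descPochhammer ℝ k * (ascPochhammer ℝ (j + 1 - k)).comp (X + C (α + 1 + k)))) -
    (C u * X + C v) * (ascPochhammer ℝ j).comp (X + C (α + 1)) with hp
  have heval : ∀ s : ℕ, p.eval (s : ℝ) = (F s - r s) * (ascPochhammer ℝ (j + 1)).eval (α + 1 + s) := by
    intro s
    have hs0 : (0 : ℝ) ≤ s := s.cast_nonneg
    have hpos : 0 < α + 1 + s := by linarith
    simp only [hp, hF]
    rw [eval_sub, sub_mul, eval_finsetSum, Finset.mul_sum, Finset.sum_mul]
    congr 1
    · refine Finset.sum_congr rfl fun k hk => ?_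
      have hk' : k ≤ j + 1 := by have := Finset.mem_range.mp hk; omega
      have hsplit := ascPochhammer_eval_add (α + 1 + s) k (j + 1 - k)
      rw [Nat.add_sub_cancel' hk'] at hsplit
      have g := Gamma_add_natCast hpos k
      have hd : (s.choose k : ℝ) * k.factorial = (descPochhammer ℝ k).eval (s : ℝ) := by
        rw [Nat.cast_choose_eq_descPochhammer_div]
        field_simp
      rw [show α + s + k + 1 = α + 1 + s + k by ring, show α + s + 1 = α + 1 + s by ring, g, hsplit]
      simp only [eval_mul, eval_C, eval_comp, eval_add, eval_X, ← hd]
      rw [show (s : ℝ) + (α + 1 + k) = α + 1 + s + k by ring]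
      have p1 := Real.Gamma_pos_of_pos hpos
      have p2 := ascPochhammer_pos k _ hpos
      field_simp
    · simp only [eval_mul, eval_C, eval_comp, eval_add, eval_X]
      rw [← hr s, ascPochhammer_succ_eval, show (s : ℝ) + (α + 1) = α + 1 + s by ring]
      ring
  have hdeg : p.natDegree < j + 2 := by
    rw [Nat.lt_succ_iff, hp, ← max_self (j + 1)]
    refine natDegree_sub_le_of_le (natDegree_sum_le_of_forall_le _ _ ?_) ?_
    · intro k hk
      have hk' : k ≤ j + 1 := by have := Finset.mem_range.mp hk; omega
      refine (natDegree_C_mul_le _ _).trans (natDegree_mul_le.trans ?_)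
      rw [natDegree_comp, natDegree_X_add_C, ascPochhammer_natDegree, descPochhammer_natDegree]
      omega
    · refine natDegree_mul_le.trans ?_
      rw [natDegree_comp, natDegree_X_add_C, ascPochhammer_natDegree]
      have := natDegree_linear_le (a := u) (b := v)
      omega
  have hp0 : p = 0 := by
    refine eq_zero_of_natDegree_lt_card_of_eval_eq_zero p (ι := Fin (j + 2))
      (f := fun i => ((i : ℕ) : ℝ)) (Nat.cast_injective.comp Fin.val_injective) (fun i => ?_)
      (by simpa using hdeg)
    rw [heval, hsmall i (by omega), sub_self, zero_mul]
  have h := heval s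
  rw [hp0, eval_zero] at h
  have hs0 : (0 : ℝ) ≤ s := s.cast_nonneg
  have p2 := ascPochhammer_pos (j + 1) (α + 1 + s) (by linarith)
  have := (mul_eq_zero.mp h.symm).resolve_right p2.ne'
  linarith

/-- Reindexed by s = k + i, with the binomial supplying zeros for s < i, so that all orders i share
the powers (z/2)^{2s} and can be added coefficientwise. -/
theorem hasSum_scaledBessel (hα : -1 < α) (i : ℕ) (z : ℂ) :
    HasSum (fun s : ℕ => (((-1) ^ s * (-1) ^ i * (s.choose i : ℝ) * i.factorial /
      (s.factorial * Real.Gamma (α + s + i + 1)) : ℝ) : ℂ) * (z / 2) ^ (2 * s))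
      (scaledBessel α i z) := by
  have hi0 : (0 : ℝ) ≤ i := i.cast_nonneg
  have ha : 0 < α + 2 * i + 1 := by linarith
  have hΓ := Real.Gamma_pos_of_pos ha
  have hterm : ∀ k : ℕ, (((-1) ^ (k + i) * (-1) ^ i * ((k + i).choose i : ℝ) * i.factorial /
      ((k + i).factorial * Real.Gamma (α + (k + i : ℕ) + i + 1)) : ℝ) : ℂ) *
        (z / 2) ^ (2 * (k + i)) = (-1 : ℂ) ^ k /
      ((k.factorial : ℂ) * (Real.Gamma (k + (α + 2 * i) + 1) : ℂ)) * (z / 2) ^ (2 * (k + i)) := by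
    intro k
    have hk0 : (0 : ℝ) ≤ k := k.cast_nonneg
    have p := Real.Gamma_pos_of_pos (show 0 < k + (α + 2 * i) + 1 by linarith)
    have h1 : ((-1 : ℝ) ^ i) * (-1) ^ i = 1 := by rw [← mul_pow]; norm_num
    have hc : ((k + i).choose i : ℝ) * i.factorial * k.factorial = (k + i).factorial := by
      have := Nat.add_choose_mul_factorial_mul_factorial k i
      rw [mul_right_comm]
      exact_mod_cast this
    have e : (-1) ^ (k + i) * (-1) ^ i * ((k + i).choose i : ℝ) * i.factorial /
        ((k + i).factorial * Real.Gamma (α + (k + i : ℕ) + i + 1)) =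
        (-1) ^ k / (k.factorial * Real.Gamma (k + (α + 2 * i) + 1)) := by
      rw [show α + ((k + i : ℕ) : ℝ) + i + 1 = k + (α + 2 * i) + 1 by push_cast; ring,
        div_eq_div_iff (by positivity) (by positivity), ← hc, pow_add]
      linear_combination ((-1) ^ k * ((k + i).choose i : ℝ) * i.factorial * k.factorial *
        Real.Gamma (k + (α + 2 * i) + 1)) * h1
    rw [e]
    push_cast
    rfl
  rw [scaledBessel_eq_tsum, ← hasSum_nat_add_iff' i, Finset.sum_eq_zero, sub_zero]
  · simp_rw [hterm]
    refine Summable.hasSum (Summable.of_norm ?_)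
    refine ((summable_pow_div_factorial_mul_ascPochhammer ha (‖z / 2‖ ^ 2)).mul_left
      (‖z / 2‖ ^ (2 * i) / Real.Gamma (α + 2 * i + 1))).congr fun k => ?_
    have hk0 : (0 : ℝ) ≤ k := k.cast_nonneg
    have g := Gamma_add_natCast ha k
    rw [show α + 2 * i + 1 + k = k + (α + 2 * i) + 1 by ring] at g
    have p := ascPochhammer_pos k _ ha
    generalize z / 2 = w
    rw [norm_mul, norm_div, norm_mul, norm_pow, norm_pow, norm_neg, norm_one, one_pow,
      Complex.norm_natCast, Complex.norm_real, Real.norm_of_nonneg (by rw [g]; positivity), g,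
      mul_add, pow_add, pow_mul, pow_mul]
    field_simp
  · intro s hs
    rw [Nat.choose_eq_zero_of_lt (Finset.mem_range.mp hs)]
    simp

/-- The coefficient of z^{2s} in the combination is, up to a factor depending only on s, the sum in
`eq_sum_besselCoeff_range`. -/
theorem hasSum_besselCombination (hα : -1 < α) (j : ℕ) {r : ℕ → ℝ} {u v : ℝ}
    (hr : ∀ i : ℕ, r i * (α + j + i + 1) = u * i + v) (z : ℂ) :
    HasSum (fun s : ℕ => ((r s * taylorLimit α s * (-1 / 2) ^ s : ℝ) : ℂ) * (z ^ 2) ^ s)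
      (besselCombination α j (besselCoeff α r) z) := by
  have h := hasSum_sum fun i (_ : i ∈ Finset.range (j + 2)) =>
    (hasSum_scaledBessel hα i z).mul_left ((besselCoeff α r i : ℂ) * 2 ^ i)
  refine h.congr_fun fun s => ?_
  have hs0 : (0 : ℝ) ≤ s := s.cast_nonneg
  have p := Real.Gamma_pos_of_pos (show 0 < α + s + 1 by linarith)
  have e : r s * taylorLimit α s * (-1 / 2) ^ s = (∑ i ∈ Finset.range (j + 2),
      besselCoeff α r i * 2 ^ i * ((-1) ^ s * (-1) ^ i * (s.choose i : ℝ) * i.factorial /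
      (s.factorial * Real.Gamma (α + s + i + 1)))) / 4 ^ s := by
    rw [taylorLimit, Finset.sum_div]
    conv_lhs => rw [eq_sum_besselCoeff_range hα j hr s]
    rw [Finset.mul_sum, Finset.sum_mul, Finset.sum_mul]
    refine Finset.sum_congr rfl fun i _ => ?_
    rw [div_pow, show (4 : ℝ) = 2 * 2 by norm_num, mul_pow]
    field_simp
  rw [e]
  have e2 : (z / 2) ^ (2 * s) = (z ^ 2) ^ s / 4 ^ s := by
    rw [pow_mul, div_pow, div_pow]
    norm_num
  rw [e2]
  push_cast
  rw [Finset.sum_div, Finset.sum_mul]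
  refine Finset.sum_congr rfl fun i _ => ?_
  ring

theorem hasSum_phiLimit (hα : -1 < α) (z : ℂ) :
    HasSum (fun s : ℕ => ((taylorLimit α s * (-1 / 2) ^ s : ℝ) : ℂ) * (z ^ 2) ^ s)
      (phiLimit α z) := by
  refine (hasSum_scaledBessel hα 0 z).congr_fun fun s => ?_
  have e2 : (z / 2) ^ (2 * s) = (z ^ 2) ^ s / 4 ^ s := by
    rw [pow_mul, div_pow, div_pow]
    norm_num
  have e : taylorLimit α s * (-1 / 2) ^ s = ((-1) ^ s * (-1) ^ 0 * (s.choose 0 : ℝ) *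
      (Nat.factorial 0) / (s.factorial * Real.Gamma (α + s + (0 : ℕ) + 1))) / 4 ^ s := by
    rw [taylorLimit, div_pow, show (4 : ℝ) = 2 * 2 by norm_num, mul_pow]
    simp
    field_simp
  rw [e, e2]
  push_cast
  ring

/-! ### From Taylor coefficients to locally uniform convergence. -/

/-- Add the cubic remainders of exp(iw) and exp(-iw). Each is at most (2/9)‖w‖³ and the odd terms
cancel. -/
theorem norm_one_sub_cos_sub_le {w : ℂ} (hw : ‖w‖ ≤ 1) :
    ‖2 * (1 - Complex.cos w) - w ^ 2‖ ≤ ‖w‖ ^ 3 := by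
  have h1 := Complex.exp_bound (x := w * Complex.I) (by simpa using hw) (n := 3) (by norm_num)
  have h2 := Complex.exp_bound (x := -w * Complex.I) (by simpa using hw) (n := 3) (by norm_num)
  simp only [Finset.sum_range_succ, Finset.sum_range_zero, norm_mul, norm_neg, Complex.norm_I,
    mul_one] at h1 h2
  have e : 2 * (1 - Complex.cos w) - w ^ 2 =
      -((Complex.exp (w * Complex.I) - (0 + (w * Complex.I) ^ 0 / (Nat.factorial 0 : ℂ) +
        (w * Complex.I) ^ 1 / (Nat.factorial 1 : ℂ) + (w * Complex.I) ^ 2 / (Nat.factorial 2 : ℂ))) +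
      (Complex.exp (-w * Complex.I) - (0 + (-w * Complex.I) ^ 0 / (Nat.factorial 0 : ℂ) +
        (-w * Complex.I) ^ 1 / (Nat.factorial 1 : ℂ) +
          (-w * Complex.I) ^ 2 / (Nat.factorial 2 : ℂ)))) := by
    rw [Complex.cos]
    simp only [Nat.factorial]
    push_cast
    linear_combination (-w ^ 2) * Complex.I_sq
  rw [e, norm_neg]
  refine (norm_add_le _ _).trans ((add_le_add h1 h2).trans ?_)
  have : (0 : ℝ) ≤ ‖w‖ ^ 3 := by positivity
  norm_num [Nat.factorial]
  linarith

theorem tendstoUniformlyOn_one_sub_cos (R : ℝ) :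
    TendstoUniformlyOn (fun (n : ℕ) (z : ℂ) => 2 * (n : ℂ) ^ 2 * (1 - Complex.cos (z / n)))
      (fun z => z ^ 2) atTop (Metric.closedBall 0 R) := by
  rw [Metric.tendstoUniformlyOn_iff]
  intro ε hε
  have hlim := tendsto_const_div_atTop_nhds_zero_nat (R ^ 3)
  filter_upwards [hlim.eventually_lt_const hε, eventually_gt_atTop 0,
    (tendsto_natCast_atTop_atTop (R := ℝ)).eventually (eventually_ge_atTop R)] with n hn hn0 hnR z hz
  have hn0' : (0 : ℝ) < n := by exact_mod_cast hn0
  have hnc : (n : ℂ) ≠ 0 := by exact_mod_cast hn0.ne'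
  have hz' : ‖z‖ ≤ R := by simpa using hz
  have hw : ‖z / n‖ ≤ 1 := by
    rw [norm_div, Complex.norm_natCast, div_le_one hn0']
    exact hz'.trans hnR
  have h := norm_one_sub_cos_sub_le hw
  rw [dist_comm, dist_eq_norm]
  have e : 2 * (n : ℂ) ^ 2 * (1 - Complex.cos (z / n)) - z ^ 2 =
      (n : ℂ) ^ 2 * (2 * (1 - Complex.cos (z / n)) - (z / n) ^ 2) := by
    field_simp
  rw [e, norm_mul, norm_pow, Complex.norm_natCast]
  refine lt_of_le_of_lt ?_ hn
  calc (n : ℝ) ^ 2 * ‖2 * (1 - Complex.cos (z / n)) - (z / n) ^ 2‖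
      ≤ (n : ℝ) ^ 2 * ‖z / n‖ ^ 3 := by gcongr
    _ = ‖z‖ ^ 3 / n := by
      rw [norm_div, Complex.norm_natCast]
      field_simp
    _ ≤ R ^ 3 / n := by gcongr

/-- Power series whose coefficients converge and are dominated converge uniformly on discs. -/
theorem tendstoUniformlyOn_tsum_of_dominated {c : ℕ → ℕ → ℝ} {l E : ℕ → ℝ}
    (hE : ∀ x : ℝ, Summable fun i => E i * x ^ i)
    (hlim : ∀ i, Tendsto (fun n => c n i) atTop (𝓝 (l i)))
    (hdom : ∀ᶠ n in atTop, ∀ i, |c n i| ≤ E i) (R : ℝ) :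
    TendstoUniformlyOn (fun n (u : ℂ) => ∑' i, (c n i : ℂ) * u ^ i) (fun u => ∑' i, (l i : ℂ) * u ^ i)
      atTop (Metric.closedBall 0 R) := by
  have hl : ∀ i, |l i| ≤ E i := fun i =>
    le_of_tendsto (hlim i).abs (hdom.mono fun n h => h i)
  have hsum : ∀ a : ℕ → ℝ, (∀ i, |a i| ≤ E i) → ∀ u : ℂ, Summable fun i => (a i : ℂ) * u ^ i := by
    intro a ha u
    refine Summable.of_norm_bounded (hE ‖u‖) fun i => ?_
    rw [norm_mul, norm_pow, Complex.norm_real, Real.norm_eq_abs]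
    gcongr
    exact ha i
  have hD : Tendsto (fun n => ∑' i, |c n i - l i| * |R| ^ i) atTop (𝓝 (∑' _ : ℕ, (0 : ℝ))) := by
    refine tendsto_tsum_of_dominated_convergence ((hE |R|).mul_left 2) (fun i => ?_)
      (hdom.mono fun n h i => ?_)
    · have := ((hlim i).sub_const (l i)).abs.mul_const (|R| ^ i)
      simpa using this
    · rw [Real.norm_of_nonneg (by positivity), ← mul_assoc]
      gcongr
      refine (abs_sub _ _).trans ?_
      linarith [h i, hl i]
  rw [tsum_zero] at hD
  rw [Metric.tendstoUniformlyOn_iff]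
  intro ε hε
  filter_upwards [hD.eventually_lt_const hε, hdom] with n hn hd u hu
  refine lt_of_le_of_lt ?_ hn
  have hu' : ‖u‖ ≤ |R| := le_trans (by simpa using hu) (le_abs_self R)
  have hsD : Summable fun i => |c n i - l i| * |R| ^ i := by
    refine Summable.of_nonneg_of_le (fun i => by positivity) (fun i => ?_) ((hE |R|).mul_left 2)
    rw [← mul_assoc]
    gcongr
    refine (abs_sub _ _).trans ?_
    linarith [hd i, hl i]
  rw [dist_comm, dist_eq_norm, ← (hsum _ hd u).tsum_sub (hsum _ hl u)]
  refine tsum_of_norm_bounded hsD.hasSum fun i => ?_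
  rw [← sub_mul, norm_mul, norm_pow, ← Complex.ofReal_sub, Complex.norm_real, Real.norm_eq_abs]
  gcongr

theorem continuous_tsum_of_dominated {l E : ℕ → ℝ} (hE : ∀ x : ℝ, Summable fun i => E i * x ^ i)
    (hl : ∀ i, |l i| ≤ E i) : Continuous fun u : ℂ => ∑' i, (l i : ℂ) * u ^ i := by
  rw [continuous_iff_continuousAt]
  intro u
  have h : ContinuousOn (fun u : ℂ => ∑' i, (l i : ℂ) * u ^ i) (Metric.closedBall 0 (‖u‖ + 1)) := by
    refine continuousOn_tsum (fun i => by fun_prop) (hE (‖u‖ + 1)) fun i v hv => ?_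
    rw [norm_mul, norm_pow, Complex.norm_real, Real.norm_eq_abs]
    have hE0 : 0 ≤ E i := (abs_nonneg _).trans (hl i)
    have hv' : ‖v‖ ≤ ‖u‖ + 1 := by simpa using hv
    gcongr
    exact hl i
  refine h.continuousAt (Filter.mem_of_superset (Metric.isOpen_ball.mem_nhds ?_)
    Metric.ball_subset_closedBall)
  simp

/-- Both arguments in the theorem have the form 1 - u/(2n²), with u = z² or u = 2n²(1 - cos(z/n)),
so one power series in u serves for both. -/
theorem aeval_one_sub_div_eq_tsum (Q : ℝ[X]) (α : ℝ) {n : ℕ} (hn : 0 < n) (u : ℂ) :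
    aeval (1 - u / (2 * (n : ℂ) ^ 2)) Q / (((n : ℝ) ^ α : ℝ) : ℂ) =
      ∑' i, (((taylor 1 Q).coeff i / ((n : ℝ) ^ α * (n : ℝ) ^ (2 * i)) * (-1 / 2) ^ i : ℝ) : ℂ) *
        u ^ i := by
  have hnc : (n : ℂ) ≠ 0 := by exact_mod_cast hn.ne'
  have hQ : aeval (1 - u / (2 * (n : ℂ) ^ 2)) Q =
      aeval (-(u / (2 * (n : ℂ) ^ 2))) (taylor 1 Q) := by
    rw [taylor_apply, aeval_comp]
    congr 2
    simp
    ring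
  rw [hQ, aeval_eq_sum_range, tsum_eq_sum (s := Finset.range ((taylor 1 Q).natDegree + 1)),
    Finset.sum_div]
  · refine Finset.sum_congr rfl fun i _ => ?_
    rw [Complex.real_smul]
    push_cast
    rw [neg_pow, div_pow, mul_pow, div_pow, ← pow_mul]
    field_simp
  · intro i hi
    rw [coeff_eq_zero_of_natDegree_lt (by simpa using hi)]
    simp

/-- Convergence and domination of the rescaled Taylor coefficients at `1` imply the
Mehler–Heine asymptotics. -/
theorem mehlerHeine_of_taylor {α : ℝ} {Q : ℕ → ℝ[X]} {F : ℂ → ℂ} {l E : ℕ → ℝ}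
    (hE : ∀ x : ℝ, Summable fun i => E i * x ^ i)
    (hlim : ∀ i, Tendsto (fun n : ℕ => (taylor 1 (Q n)).coeff i / ((n : ℝ) ^ α * (n : ℝ) ^ (2 * i)))
      atTop (𝓝 (l i)))
    (hdom : ∀ᶠ n : ℕ in atTop, ∀ i,
      |(taylor 1 (Q n)).coeff i / ((n : ℝ) ^ α * (n : ℝ) ^ (2 * i))| ≤ E i)
    (hF : ∀ z, HasSum (fun i => ((l i * (-1 / 2) ^ i : ℝ) : ℂ) * (z ^ 2) ^ i) (F z)) :
    MehlerHeine α Q F := by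
  set c : ℕ → ℕ → ℝ := fun n i =>
    (taylor 1 (Q n)).coeff i / ((n : ℝ) ^ α * (n : ℝ) ^ (2 * i)) * (-1 / 2) ^ i with hc
  have hlim' : ∀ i, Tendsto (fun n => c n i) atTop (𝓝 (l i * (-1 / 2) ^ i)) := fun i =>
    (hlim i).mul_const _
  have hdom' : ∀ᶠ n in atTop, ∀ i, |c n i| ≤ E i := by
    refine hdom.mono fun n h i => ?_
    rw [hc, abs_mul]
    refine (mul_le_of_le_one_right (abs_nonneg _) ?_).trans (h i)
    rw [abs_pow]
    exact pow_le_one₀ (abs_nonneg _) (by norm_num [abs_div])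
  have hl : ∀ i, |l i * (-1 / 2) ^ i| ≤ E i := fun i =>
    le_of_tendsto (hlim' i).abs (hdom'.mono fun n h => h i)
  have hFG : F = fun z => ∑' i, ((l i * (-1 / 2) ^ i : ℝ) : ℂ) * (z ^ 2) ^ i :=
    funext fun z => (hF z).tsum_eq.symm
  intro K hK
  obtain ⟨R, hKR⟩ := hK.isBounded.subset_closedBall (0 : ℂ)
  -- The extra 1 in the radius leaves room for 2n²(1 - cos(z/n)), which is only close to z².
  have hunif := tendstoUniformlyOn_tsum_of_dominated hE hlim' hdom' (R ^ 2 + 1)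
  have hcont := continuous_tsum_of_dominated hE hl
  have hsq : ∀ z ∈ K, ‖z ^ 2‖ ≤ R ^ 2 := by
    intro z hz
    have : ‖z‖ ≤ R := by simpa using hKR hz
    rw [norm_pow]
    gcongr
  rw [hFG]
  constructor
  · have hu := (tendstoUniformlyOn_one_sub_cos R).mono hKR
    have hmem : ∀ᶠ n : ℕ in atTop, ∀ z ∈ K,
        2 * (n : ℂ) ^ 2 * (1 - Complex.cos (z / n)) ∈ Metric.closedBall (0 : ℂ) (R ^ 2 + 1) := by
      filter_upwards [Metric.tendstoUniformlyOn_iff.mp hu 1 one_pos] with n hn z hz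
      have h1 := hn z hz
      rw [dist_comm, dist_eq_norm] at h1
      have h2 := norm_le_norm_add_norm_sub' (2 * (n : ℂ) ^ 2 * (1 - Complex.cos (z / n))) (z ^ 2)
      simp only [mem_closedBall_zero_iff]
      linarith [hsq z hz]
    -- The limit series is uniformly continuous on the disc, so replacing z² by its cosine
    -- approximation costs at most ε/2. The other ε/2 is the error of the series itself.
    have hG := UniformContinuousOn.comp_tendstoUniformlyOn_eventually hmem
      (fun z hz => by
        simp only [mem_closedBall_zero_iff]
        linarith [hsq z hz])
      ((isCompact_closedBall (0 : ℂ) (R ^ 2 + 1)).uniformContinuousOn_of_continuous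
        hcont.continuousOn) hu
    rw [Metric.tendstoUniformlyOn_iff] at hG hunif ⊢
    intro ε hε
    filter_upwards [hG (ε / 2) (half_pos hε), hunif (ε / 2) (half_pos hε), hmem,
      eventually_gt_atTop 0] with n h1 h2 h3 hn z hz
    have hnc : (n : ℂ) ≠ 0 := by exact_mod_cast hn.ne'
    have e := aeval_one_sub_div_eq_tsum (Q n) α hn (2 * (n : ℂ) ^ 2 * (1 - Complex.cos (z / n)))
    rw [mul_div_cancel_left₀ _ (by simpa using hnc), sub_sub_cancel] at e
    rw [e]
    refine (dist_triangle _ _ _).trans_lt ((add_lt_add (h1 z hz) (h2 _ (h3 z hz))).trans_eq ?_)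
    ring
  · rw [Metric.tendstoUniformlyOn_iff] at hunif ⊢
    intro ε hε
    filter_upwards [hunif ε hε, eventually_gt_atTop 0] with n h hn z hz
    rw [aeval_one_sub_div_eq_tsum (Q n) α hn]
    exact h _ (by
      simp only [mem_closedBall_zero_iff]
      linarith [hsq z hz])

/-! ### Majorants uniform in the degree. -/

/-- A majorant of the rescaled Taylor coefficients at `1` of the Jacobi polynomials. -/
noncomputable def taylorMajorant (α β : ℝ) (i : ℕ) : ℝ :=
  (2 + |α + β + 1|) ^ i / (i.factorial * (ascPochhammer ℝ i).eval (α + 1))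

theorem taylorMajorant_nonneg (hα : -1 < α) (β : ℝ) (i : ℕ) : 0 ≤ taylorMajorant α β i := by
  have p := ascPochhammer_pos i (α + 1) (by linarith)
  rw [taylorMajorant]
  positivity

theorem summable_taylorMajorant (hα : -1 < α) (β x : ℝ) :
    Summable fun i => taylorMajorant α β i * x ^ i := by
  refine (summable_pow_div_factorial_mul_ascPochhammer (a := α + 1) (by linarith)
    ((2 + |α + β + 1|) * x)).congr fun i => ?_
  rw [taylorMajorant, mul_pow]
  ring

theorem ascPochhammer_eval_nonneg (hα : -1 < α) (hβ : -1 < β) {n i : ℕ} (h : i ≤ n) :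
    0 ≤ (ascPochhammer ℝ i).eval ((n : ℝ) + (α + β + 1)) := by
  rcases Nat.eq_zero_or_pos n with rfl | hn
  · obtain rfl : i = 0 := by omega
    simp
  · have : (1 : ℝ) ≤ n := by exact_mod_cast hn
    exact (ascPochhammer_pos _ _ (by linarith)).le

theorem ascPochhammer_eval_le {x : ℝ} (hx : 0 < x) (i : ℕ) :
    (ascPochhammer ℝ i).eval x ≤ (x + i) ^ i := by
  induction i with
  | zero => simp
  | succ i ih =>
    rw [ascPochhammer_succ_eval, pow_succ]
    have h := (ascPochhammer_pos i x hx).le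
    push_cast
    have h2 : (x + i) ^ i ≤ (x + (i + 1)) ^ i := by gcongr; linarith
    exact mul_le_mul (ih.trans h2) (by linarith) (by positivity) (by positivity)

theorem jacobiTaylor_zero_nonneg (hα : -1 < α) (β : ℝ) (n : ℕ) : 0 ≤ jacobiTaylor α β n 0 := by
  rw [jacobiTaylor_zero hα]
  have hn0 : (0 : ℝ) ≤ n := n.cast_nonneg
  have p1 := Real.Gamma_pos_of_pos (show 0 < α + 1 by linarith)
  have p2 := Real.Gamma_pos_of_pos (show 0 < n + α + 1 by linarith)
  positivity

theorem jacobiTaylor_nonneg (hα : -1 < α) (hβ : -1 < β) (n i : ℕ) : 0 ≤ jacobiTaylor α β n i := by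
  rcases lt_or_ge n i with h | h
  · simp [jacobiTaylor, Nat.choose_eq_zero_of_lt h]
  rw [jacobiTaylor_eq_mul hα]
  have p := ascPochhammer_pos i (α + 1) (by linarith)
  have := ascPochhammer_eval_nonneg hα hβ h
  have := jacobiTaylor_zero_nonneg hα β n
  positivity

theorem jacobiTaylor_le (hα : -1 < α) (hβ : -1 < β) (n i : ℕ) :
    jacobiTaylor α β n i ≤ jacobiTaylor α β n 0 * (taylorMajorant α β i * (n : ℝ) ^ (2 * i)) := by
  have h0 := jacobiTaylor_zero_nonneg hα β n
  have hE := taylorMajorant_nonneg hα β i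
  rcases lt_or_ge n i with h | h
  · have : jacobiTaylor α β n i = 0 := by simp [jacobiTaylor, Nat.choose_eq_zero_of_lt h]
    rw [this]
    positivity
  rw [jacobiTaylor_eq_mul hα β n i]
  refine mul_le_mul_of_nonneg_left ?_ h0
  rcases Nat.eq_zero_or_pos n with rfl | hn
  · obtain rfl : i = 0 := by omega
    simp [taylorMajorant]
  have hn1 : (1 : ℝ) ≤ n := by exact_mod_cast hn
  have hin : (i : ℝ) ≤ n := by exact_mod_cast h
  have p := ascPochhammer_pos i (α + 1) (by linarith)
  have hx : 0 < (n : ℝ) + (α + β + 1) := by linarith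
  have hc : (n.choose i : ℝ) ≤ (n : ℝ) ^ i / i.factorial := Nat.choose_le_pow_div i n
  -- Here i ≤ n and n ≥ 1 give n + (α+β+1) + i ≤ (2 + |α+β+1|)n, which is the source of the constant
  -- in the majorant.
  have hP : (ascPochhammer ℝ i).eval ((n : ℝ) + (α + β + 1)) ≤ ((2 + |α + β + 1|) * n) ^ i := by
    refine (ascPochhammer_eval_le hx i).trans ?_
    gcongr
    have h1 := le_abs_self (α + β + 1)
    have h2 := le_mul_of_one_le_right (abs_nonneg (α + β + 1)) hn1
    linarith
  have h2 : (1 : ℝ) ≤ 2 ^ i := one_le_pow₀ (by norm_num)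
  calc (n.choose i : ℝ) * (ascPochhammer ℝ i).eval ((n : ℝ) + (α + β + 1)) /
        ((ascPochhammer ℝ i).eval (α + 1) * 2 ^ i)
      ≤ (n : ℝ) ^ i / i.factorial * ((2 + |α + β + 1|) * n) ^ i /
        ((ascPochhammer ℝ i).eval (α + 1) * 1) := by
        have := (ascPochhammer_pos i _ hx).le
        gcongr
    _ = taylorMajorant α β i * (n : ℝ) ^ (2 * i) := by
        rw [taylorMajorant, mul_pow, two_mul, pow_add]
        field_simp

theorem kernelTaylor_nonneg (hα : -1 < α) (hβ : -1 < β) (j n i : ℕ) :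
    0 ≤ kernelTaylor hα hβ j n i := by
  refine Finset.sum_nonneg fun k _ => ?_
  have h1 := jacobiTaylor_nonneg hα hβ k i
  have h2 := jacobiTaylor_nonneg hα hβ k j
  have h3 := jacobiNormSq_pos hα hβ k
  positivity

/-- Termwise from the Jacobi bound: all terms are nonnegative and k ≤ n. -/
theorem kernelTaylor_le (hα : -1 < α) (hβ : -1 < β) (j n i : ℕ) :
    kernelTaylor hα hβ j n i ≤
      kernelTaylor hα hβ j n 0 * (taylorMajorant α β i * (n : ℝ) ^ (2 * i)) := by
  rw [kernelTaylor, kernelTaylor, Finset.sum_mul]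
  refine Finset.sum_le_sum fun k hk => ?_
  have hkn : (k : ℝ) ≤ n := by exact_mod_cast (Finset.mem_range.mp hk).le
  have h0 := jacobiTaylor_zero_nonneg hα β k
  have h2 := jacobiTaylor_nonneg hα hβ k j
  have h3 := jacobiNormSq_pos hα hβ k
  have hE := taylorMajorant_nonneg hα β i
  rw [mul_right_comm]
  gcongr
  refine (jacobiTaylor_le hα hβ k i).trans ?_
  gcongr

/-! ### Limits of the Sobolev coefficients. -/

/-- The rescaled mass `m n ^ (2 (α + 2j + 1))`, damped by the rescaled kernel. -/
noncomputable def dampedMass (hα : -1 < α) (hβ : -1 < β) (j : ℕ) (m : ℝ) (n : ℕ) : ℝ :=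
  m * (n : ℝ) ^ (2 * (α + 2 * j + 1)) / (1 + m * (n : ℝ) ^ (2 * (α + 2 * j + 1)) *
    (kernelTaylor hα hβ j n j / (n : ℝ) ^ (2 * (α + j + j + 1))))

theorem taylor_coeff_div_eq (hα : -1 < α) (hβ : -1 < β) {j n : ℕ} {m : ℝ} (hm : 0 ≤ m)
    {Q : ℝ[X]} (hQ : IsJacobiSobolev α β j m n Q) (hn : 0 < n) (i : ℕ) :
    (taylor 1 Q).coeff i / ((n : ℝ) ^ α * (n : ℝ) ^ (2 * i)) =
      jacobiTaylor α β n i / ((n : ℝ) ^ α * (n : ℝ) ^ (2 * i)) -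
        dampedMass hα hβ j m n * (jacobiTaylor α β n j / ((n : ℝ) ^ α * (n : ℝ) ^ (2 * j))) *
          (kernelTaylor hα hβ j n i / (n : ℝ) ^ (2 * (α + i + j + 1))) := by
  have hn0 : (0 : ℝ) < n := by exact_mod_cast hn
  have hS := kernelTaylor_nonneg hα hβ j n j
  have hpos : 0 < 1 + m * kernelTaylor hα hβ j n j := by positivity
  -- The kernel relation at i = j is linear in this coefficient. Nonnegativity of mass and kernel
  -- makes its factor positive.
  have hj : (taylor 1 Q).coeff j =
      jacobiTaylor α β n j / (1 + m * kernelTaylor hα hβ j n j) := by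
    rw [eq_div_iff hpos.ne']
    linear_combination taylor_coeff_eq_of_isJacobiSobolev hα hβ hQ j
  have p1 := Real.rpow_pos_of_pos hn0 α
  have e : ∀ k : ℕ, (n : ℝ) ^ (2 * (α + k + j + 1)) =
      (n : ℝ) ^ α * (n : ℝ) ^ α * (n : ℝ) ^ (2 * k) * (n : ℝ) ^ (2 * j) * (n : ℝ) ^ 2 := by
    intro k
    rw [← Real.rpow_natCast, ← Real.rpow_natCast, ← Real.rpow_natCast, ← Real.rpow_add hn0,
      ← Real.rpow_add hn0, ← Real.rpow_add hn0, ← Real.rpow_add hn0]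
    congr 1
    push_cast
    ring
  have e' : 2 * (α + 2 * j + 1) = 2 * (α + j + j + 1) := by ring
  rw [taylor_coeff_eq_of_isJacobiSobolev hα hβ hQ i, hj, dampedMass, e', e i, e j]
  generalize kernelTaylor hα hβ j n j = S at *
  field_simp

/-- The three regimes differ only in τ, which enters the limit coefficients through r. -/
theorem mehlerHeine_of_tendsto_dampedMass (hα : -1 < α) (hβ : -1 < β) {j : ℕ} {m : ℕ → ℝ}
    (hm : ∀ n, 0 ≤ m n) {Q : ℕ → ℝ[X]} (hQ : ∀ n, IsJacobiSobolev α β j (m n) n (Q n)) {τ : ℝ}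
    (hτ : Tendsto (fun n => dampedMass hα hβ j (m n) n) atTop (𝓝 τ)) {F : ℂ → ℂ} {r : ℕ → ℝ}
    (hr : ∀ i : ℕ, r i = 1 - τ * ((α + 2 * j + 1) / (criticalMass α β j * (α + j + i + 1))))
    (hF : ∀ z, HasSum (fun i => ((r i * taylorLimit α i * (-1 / 2) ^ i : ℝ) : ℂ) * (z ^ 2) ^ i)
      (F z)) :
    MehlerHeine α Q F := by
  have hθ : ∀ n, 0 ≤ dampedMass hα hβ j (m n) n := fun n => by
    have h1 := hm n
    have h2 := kernelTaylor_nonneg hα hβ j n j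
    rw [dampedMass]
    positivity
  have hXY := fun i => (hτ.mul (tendsto_jacobiTaylor_div hα β j)).mul
    (tendsto_kernelTaylor_div hα hβ j i)
  -- The Jacobi and kernel parts at i = 0, added instead of subtracted. The majorants bound every
  -- other i by `taylorMajorant α β i` times this quantity, so one bound B, valid for all large n,
  -- suffices.
  have hbound := (tendsto_jacobiTaylor_zero_div hα β).add (hXY 0)
  obtain ⟨B, hB⟩ := hbound.isBoundedUnder_le
  rw [eventually_map] at hB
  refine mehlerHeine_of_taylor (E := fun i => B * taylorMajorant α β i) (fun x => ?_) (fun i => ?_)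
    ?_ hF
  · simpa [mul_assoc] using (summable_taylorMajorant hα β x).mul_left B
  · have h := (tendsto_jacobiTaylor_div hα β i).sub (hXY i)
    have e : taylorLimit α i - τ * taylorLimit α j * kernelLimit α β j i =
        r i * taylorLimit α i := by
      rw [mul_assoc, kernelLimit_eq hα, hr]
      ring
    rw [e] at h
    refine h.congr' ?_
    filter_upwards [eventually_gt_atTop 0] with n hn
    exact (taylor_coeff_div_eq hα hβ (hm n) (hQ n) hn i).symm
  · filter_upwards [hB, eventually_gt_atTop 0] with n hBn hn i
    have hn0 : (0 : ℝ) < n := by exact_mod_cast hn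
    rw [taylor_coeff_div_eq hα hβ (hm n) (hQ n) hn i]
    have p1 := Real.rpow_pos_of_pos hn0 α
    have p2 := Real.rpow_pos_of_pos hn0 (2 * (α + (0 : ℕ) + j + 1))
    have hE := taylorMajorant_nonneg hα β i
    have hd := jacobiTaylor_nonneg hα hβ n i
    have hdj := jacobiTaylor_nonneg hα hβ n j
    have hS := kernelTaylor_nonneg hα hβ j n i
    have hexp : (n : ℝ) ^ (2 * (α + i + j + 1)) =
        (n : ℝ) ^ (2 * (α + (0 : ℕ) + j + 1)) * (n : ℝ) ^ (2 * i) := by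
      rw [← Real.rpow_natCast, ← Real.rpow_add hn0]
      congr 1
      push_cast
      ring
    have h1 : jacobiTaylor α β n i / ((n : ℝ) ^ α * (n : ℝ) ^ (2 * i)) ≤
        jacobiTaylor α β n 0 / (n : ℝ) ^ α * taylorMajorant α β i := by
      rw [div_le_iff₀ (by positivity)]
      refine (jacobiTaylor_le hα hβ n i).trans_eq ?_
      field_simp
    have h2 : kernelTaylor hα hβ j n i / (n : ℝ) ^ (2 * (α + i + j + 1)) ≤
        kernelTaylor hα hβ j n 0 / (n : ℝ) ^ (2 * (α + (0 : ℕ) + j + 1)) * taylorMajorant α β i := by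
      rw [hexp, div_le_iff₀ (by positivity)]
      refine (kernelTaylor_le hα hβ j n i).trans_eq ?_
      field_simp
    have hc : 0 ≤ dampedMass hα hβ j (m n) n *
        (jacobiTaylor α β n j / ((n : ℝ) ^ α * (n : ℝ) ^ (2 * j))) :=
      mul_nonneg (hθ n) (by positivity)
    have h3 := mul_le_mul_of_nonneg_left h2 hc
    refine (abs_sub _ _).trans ?_
    rw [abs_of_nonneg (by positivity), abs_of_nonneg (mul_nonneg hc (by positivity))]
    refine (add_le_add h1 h3).trans ?_
    rw [← mul_assoc, ← add_mul]
    gcongr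

/-! ### The three regimes of the mass. -/

theorem tendsto_dampedMass (hα : -1 < α) (hβ : -1 < β) {j : ℕ} {m : ℕ → ℝ} {t : ℝ} (ht : 0 ≤ t)
    (h : Tendsto (fun n : ℕ => m n * (n : ℝ) ^ (2 * (α + 2 * j + 1))) atTop (𝓝 t)) :
    Tendsto (fun n => dampedMass hα hβ j (m n) n) atTop
      (𝓝 (t / (1 + t * (1 / criticalMass α β j)))) := by
  have hZ := tendsto_kernelTaylor_div hα hβ j j
  rw [kernelLimit_self hα] at hZ
  have p := criticalMass_pos hα β j
  exact h.div ((h.mul hZ).const_add 1) (by positivity)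

theorem tendsto_dampedMass_of_atTop (hα : -1 < α) (hβ : -1 < β) {j : ℕ} {m : ℕ → ℝ}
    (h : Tendsto (fun n : ℕ => m n * (n : ℝ) ^ (2 * (α + 2 * j + 1))) atTop atTop) :
    Tendsto (fun n => dampedMass hα hβ j (m n) n) atTop (𝓝 (criticalMass α β j)) := by
  have hZ := tendsto_kernelTaylor_div hα hβ j j
  rw [kernelLimit_self hα] at hZ
  have p := criticalMass_pos hα β j
  -- The damped mass t/(1 + tZ) equals 1/(1/t + Z), whose limit as t grows does not depend on the
  -- rate.
  have h1 := ((tendsto_inv_atTop_zero.comp h).add hZ).inv₀ (by positivity)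
  rw [zero_add, one_div, inv_inv] at h1
  refine h1.congr' ?_
  filter_upwards [h.eventually_gt_atTop 0] with n hn
  simp only [Function.comp_apply, dampedMass]
  generalize m n * (n : ℝ) ^ (2 * (α + 2 * j + 1)) = t at hn
  generalize kernelTaylor hα hβ j n j / (n : ℝ) ^ (2 * (α + j + j + 1)) = Z
  rw [← one_div_div, ← one_div]
  congr 1
  field_simp

theorem varphiData_eq (hα : -1 < α) (β : ℝ) (j i : ℕ) :
    varphiData α j i = 1 - criticalMass α β j *
      ((α + 2 * j + 1) / (criticalMass α β j * (α + j + i + 1))) := by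
  have hi0 : (0 : ℝ) ≤ i := i.cast_nonneg
  have hj0 : (0 : ℝ) ≤ j := j.cast_nonneg
  have p := criticalMass_pos hα β j
  have p2 : 0 < α + j + i + 1 := by linarith
  rw [varphiData]
  field_simp
  ring

theorem psiData_eq (hα : -1 < α) (β : ℝ) {M : ℝ} (hM : 0 < M) (j i : ℕ) :
    psiData α β j M i = 1 - M / (1 + M * (1 / criticalMass α β j)) *
      ((α + 2 * j + 1) / (criticalMass α β j * (α + j + i + 1))) := by
  have hi0 : (0 : ℝ) ≤ i := i.cast_nonneg
  have hj0 : (0 : ℝ) ≤ j := j.cast_nonneg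
  have p := criticalMass_pos hα β j
  have p2 : 0 < α + j + i + 1 := by linarith
  rw [psiData]
  generalize criticalMass α β j = c at *
  have p3 : c + M ≠ 0 := by positivity
  field_simp
  ring

end JacobiSobolev

open JacobiSobolev

theorem theorem2 (α β : ℝ) (hα : -1 < α) (hβ : -1 < β) (j : ℕ) (γ M : ℝ) (hM : 0 < M)
    (m : ℕ → ℝ) (hm_nonneg : ∀ n, 0 ≤ m n)
    (hm_lim : Tendsto (fun n : ℕ => m n * (n : ℝ) ^ γ) atTop (𝓝 M))
    (Q : ℕ → ℝ[X]) (hQ : ∀ n, IsJacobiSobolev α β j (m n) n (Q n)) :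
    (2 * (α + 2 * j + 1) < γ → MehlerHeine α Q (phiLimit α)) ∧
    (γ = 2 * (α + 2 * j + 1) → MehlerHeine α Q (psiLimit α β j M)) ∧
    (γ < 2 * (α + 2 * j + 1) → MehlerHeine α Q (varphiLimit α j)) := by
  have hj0 : (0 : ℝ) ≤ j := j.cast_nonneg
  have hcrit := criticalMass_pos hα β j
  have hsplit : (fun n : ℕ => m n * (n : ℝ) ^ γ * (n : ℝ) ^ (2 * (α + 2 * j + 1) - γ)) =ᶠ[atTop]
      fun n : ℕ => m n * (n : ℝ) ^ (2 * (α + 2 * j + 1)) := by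
    filter_upwards [eventually_gt_atTop 0] with n hn
    rw [mul_assoc, ← Real.rpow_add (by exact_mod_cast hn), add_sub_cancel]
  refine ⟨fun hγ => ?_, fun hγ => ?_, fun hγ => ?_⟩
  · have h := (hm_lim.mul ((tendsto_rpow_neg_atTop (sub_pos.mpr hγ)).comp
      tendsto_natCast_atTop_atTop)).congr' (by simpa using hsplit)
    rw [mul_zero] at h
    -- The rescaled mass vanishes, so τ = 0 and every r_i is 1: the Jacobi limit is unchanged.
    refine mehlerHeine_of_tendsto_dampedMass hα hβ hm_nonneg hQ
      (tendsto_dampedMass hα hβ le_rfl h) (r := fun _ => 1) (fun i => by simp) fun z => ?_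
    simpa using hasSum_phiLimit hα z
  · rw [hγ] at hm_lim
    refine mehlerHeine_of_tendsto_dampedMass hα hβ hm_nonneg hQ
      (tendsto_dampedMass hα hβ hM.le hm_lim) (psiData_eq hα β hM j)
      -- Multiplying r_i by α+j+i+1 gives (M(i-j) + c(α+j+i+1))/(M+c), whose slope in i is 1; v is
      -- its value at i = 0.
      (hasSum_besselCombination hα j (u := 1)
        (v := (criticalMass α β j * (α + j + 1) - M * j) / (M + criticalMass α β j)) fun i => ?_)
    have hi0 : (0 : ℝ) ≤ i := i.cast_nonneg
    have p2 : 0 < α + j + i + 1 := by linarith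
    rw [psiData]
    generalize criticalMass α β j = c at *
    field_simp
    ring
  · have h := (hm_lim.pos_mul_atTop hM ((tendsto_rpow_atTop (sub_pos.mpr hγ)).comp
      tendsto_natCast_atTop_atTop)).congr' hsplit
    refine mehlerHeine_of_tendsto_dampedMass hα hβ hm_nonneg hQ
      (tendsto_dampedMass_of_atTop hα hβ h) (varphiData_eq hα β j)
      (hasSum_besselCombination hα j (u := 1) (v := -j) fun i => ?_)
    have hi0 : (0 : ℝ) ≤ i := i.cast_nonneg
    have p2 : 0 < α + j + i + 1 := by linarith
    rw [varphiData]
    field_simp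
    ring
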